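/- Let $A$ be a finite set of options. A Llull matrix on $A$ assigns to every ordered pair of different options $x,y$ a score $v_{xy}\in[0,1]$ with $v_{xy}+v_{yx}\le 1$; it is non-vanishing if $v_{xy}\ne 0$ for some $x\ne y$. Put $t_{xy}=v_{xy}+v_{yx}$. CLC projection. Let $v^*_{xy}=\max\min_i v_{x_ix_{i+1}}$, the maximum being over all paths $x_0x_1\dots x_n$ from $x_0=x$ to $x_n=y$, and let $m^*_{xy}=v^*_{xy}-v^*_{yx}$. Choose a total order $\xi$ on $A$ that is admissible, i.e. such that $x$ precedes $y$ whenever $m^*_{xy}>0$; write $p\preceq q$ if $p=q$ or $p$ precedes $q$, and $p\prec q$ if moreover $p\ne q$, and let $x'$ be the option that immediately follows $x$. For $x\prec y$ put $m^\sigma_{xy}=\min\{m^*_{pq}\mid p\preceq x,\ y\preceq q\}$. Let $(t^\sigma_{xy})$ be the orthogonal projection (least Euclidean distance) of $(t_{xy})$ onto the convex set of all symmetric systems $(\tau_{xy})_{x\neq y}$ of real numbers such that $m^\sigma_{xx'}\le\tau_{xx'}\le 1$ for every $x$ that has a successor $x'$, and $0\le\tau_{xz}-\tau_{x'z}\le m^\sigma_{xx'}$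 for every such $x$ and every $z\notin\{x,x'\}$. The projected matrix $(v^\pi_{xy})$ is defined, for $x\prec y$, by $$v^\pi_{xy}=\max_{x\preceq p\prec y}\tfrac12\left(t^\sigma_{pp'}+m^\sigma_{pp'}\right),\qquad v^\pi_{yx}=\min_{x\preceq p\prec y}\tfrac12\left(t^\sigma_{pp'}-m^\sigma_{pp'}\right).$$ Strengths. Let $Q=\{\varphi\in\mathbb R^A\mid\varphi_x>0\text{ for all }x,\ \sum_x\varphi_x=1\}$ and, for a matrix $w$, $$F_w(\varphi)=\prod_{\{x,y\},\,x\ne y}\frac{\varphi_x^{w_{xy}}\varphi_y^{w_{yx}}}{(\varphi_x+\varphi_y)^{w_{xy}+w_{yx}}}\qquad(\varphi\in Q).$$ The strengths of $w$ are the point $\varphi\in\overline Q$ to which every maximizing sequence of $F_w$ converges (a sequence $\psi^n\in Q$ is maximizing if $F_w(\psi^n)\to\sup_Q F_w$). The fraction-like rates of $v$ are the strengths of its projected matrix $v^\pi$. Theorem. For every non-vanishing Llull matrix $v$ the projected matrix is well defined (it exists and does not depend on the choice of the admissible order), and the fraction-like rates of $v$ exist and are unique. The fraction-like rates are a continuous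 function of $v$ on the set of non-vanishing Llull matrices. -/

import Mathlib

open Set Filter Topology

namespace CLC

variable {A : Type*} [Fintype A]

/-- A Llull matrix (matrix of preference scores) on the finite set of options `A`: every ordered
pair of different options carries a score in `[0, 1]`, and opposite scores add up to at most `1`.
The diagonal carries no information and is put equal to `0`. -/
structure IsLlull (v : A → A → ℝ) : Prop where
  diag : ∀ x, v x x = 0
  mem_Icc : ∀ x y, x ≠ y → v x y ∈ Icc (0 : ℝ) 1
  add_le_one : ∀ x y, x ≠ y → v x y + v y x ≤ 1

/-- The non-vanishing Llull matrices. -/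
def nonvanishingLlull (A : Type*) : Set (A → A → ℝ) :=
  {v | IsLlull v ∧ ∃ x y, x ≠ y ∧ v x y ≠ 0}

/-- The turnouts `t x y = v x y + v y x`. -/
def turnout (v : A → A → ℝ) (x y : A) : ℝ := v x y + v y x

/-- The indirect score: the maximum, over all paths `x₀ x₁ … xₙ` (`n ≥ 1`, consecutive options
different) from `x₀ = x` to `xₙ = y`, of the score of the weakest link. -/
noncomputable def indirectScore (v : A → A → ℝ) (x y : A) : ℝ :=
  sSup {s | ∃ (n : ℕ) (p : Fin (n + 2) → A), p 0 = x ∧ p (Fin.last (n + 1)) = y ∧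
    (∀ i : Fin (n + 1), p i.castSucc ≠ p i.succ) ∧
    s = ⨅ i : Fin (n + 1), v (p i.castSucc) (p i.succ)}

/-- The indirect margins. -/
noncomputable def indirectMargin (v : A → A → ℝ) (x y : A) : ℝ :=
  indirectScore v x y - indirectScore v y x

/-- A total order on the options, given by the position of each option. Thus `x` precedes `y`
when `ξ x < ξ y`. -/
abbrev Ranking (A : Type*) [Fintype A] := A ≃ Fin (Fintype.card A)

/-- `y` immediately follows `x` in the order `ξ`. -/
def Ranking.Next (ξ : Ranking A) (x y : A) : Prop := (ξ y : ℕ) = (ξ x : ℕ) + 1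

/-- An admissible order for `v`: a total order that contains the relation
"the indirect score of `x` over `y` is greater than that of `y` over `x`". -/
def IsAdmissible (v : A → A → ℝ) (ξ : Ranking A) : Prop :=
  ∀ x y, indirectScore v y x < indirectScore v x y → ξ x < ξ y

/-- The intermediate projected margins
`min {m* p q | p = x or p precedes x, q = y or q follows y}` (used when `x` precedes `y`). -/
noncomputable def intermediateMargin (v : A → A → ℝ) (ξ : Ranking A) (x y : A) : ℝ :=
  sInf {m | ∃ p q, ξ p ≤ ξ x ∧ ξ y ≤ ξ q ∧ m = indirectMargin v p q}

/-- The convex set of turnouts compatible with the margins `m x x'` between consecutive options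
of the order `ξ`. -/
structure IsCompatibleTurnout (ξ : Ranking A) (m τ : A → A → ℝ) : Prop where
  diag : ∀ x, τ x x = 0
  symm : ∀ x y, τ x y = τ y x
  bounds : ∀ x x', ξ.Next x x' → m x x' ≤ τ x x' ∧ τ x x' ≤ 1
  diff : ∀ x x' z, ξ.Next x x' → z ≠ x → z ≠ x' →
    0 ≤ τ x z - τ x' z ∧ τ x z - τ x' z ≤ m x x'

open scoped Classical in
/-- `τ` is the matrix of intermediate projected turnouts: the orthogonal projection of the
turnouts of `v` onto the convex set of turnouts compatible with the intermediate projected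
margins, i.e. the point of that set at the least Euclidean distance. -/
def IsIntermediateTurnout (v : A → A → ℝ) (ξ : Ranking A) (τ : A → A → ℝ) : Prop :=
  IsCompatibleTurnout ξ (intermediateMargin v ξ) τ ∧
  ∀ τ' : A → A → ℝ, IsCompatibleTurnout ξ (intermediateMargin v ξ) τ' →
    ∑ x, ∑ y with y ≠ x, (τ x y - turnout v x y) ^ 2 ≤
      ∑ x, ∑ y with y ≠ x, (τ' x y - turnout v x y) ^ 2

/-- The scores built from the margins and turnouts between consecutive options of `ξ`. Every pair
of consecutive options `p p'` has the interval `[(τ p p' - m p p') / 2, (τ p p' + m p p') / 2]`;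
when `x` precedes `y`, the score of `x` over `y` is the maximum, and that of `y` over `x` is the
minimum, of the union of these intervals for `p p'` between `x` and `y`. -/
noncomputable def scoresOfConsecutive (ξ : Ranking A) (m τ : A → A → ℝ) (x y : A) : ℝ :=
  if ξ x < ξ y then
    sSup {s | ∃ p p', ξ.Next p p' ∧ ξ x ≤ ξ p ∧ ξ p' ≤ ξ y ∧ s = (τ p p' + m p p') / 2}
  else if ξ y < ξ x then
    sInf {s | ∃ p p', ξ.Next p p' ∧ ξ y ≤ ξ p ∧ ξ p' ≤ ξ x ∧ s = (τ p p' - m p p') / 2}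
  else 0

/-- `w` is a result of the CLC projection procedure applied to `v`, for some choice of an
admissible order. -/
def IsCLCProjection (v w : A → A → ℝ) : Prop :=
  ∃ ξ : Ranking A, IsAdmissible v ξ ∧ ∃ τ : A → A → ℝ, IsIntermediateTurnout v ξ τ ∧
    w = scoresOfConsecutive ξ (intermediateMargin v ξ) τ

/-- The positive strengths that add up to `1`. -/
def strengthSet (A : Type*) [Fintype A] : Set (A → ℝ) :=
  {φ | (∀ x, 0 < φ x) ∧ ∑ x, φ x = 1}

open scoped Classical in
/-- Zermelo's likelihood function. Grouping the factors of `(x, y)` and `(y, x)`, it is the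
product over the unordered pairs `{x, y}` of
`φ x ^ w x y * φ y ^ w y x / (φ x + φ y) ^ (w x y + w y x)`. -/
noncomputable def likelihood (w : A → A → ℝ) (φ : A → ℝ) : ℝ :=
  ∏ x, ∏ y with y ≠ x, (φ x / (φ x + φ y)) ^ w x y

/-- `φ` is the vector of strengths given by Zermelo's method for `w`: the point of the closed
simplex to which every maximizing sequence of the likelihood converges. -/
def IsStrengths (w : A → A → ℝ) (φ : A → ℝ) : Prop :=
  φ ∈ closure (strengthSet A) ∧
  ∀ ψ : ℕ → A → ℝ, (∀ n, ψ n ∈ strengthSet A) →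
    Tendsto (fun n => likelihood w (ψ n)) atTop (𝓝 (sSup (likelihood w '' strengthSet A))) →
    Tendsto ψ atTop (𝓝 φ)

/-- `φ` is the vector of fraction-like rates of `v`: the strengths of a CLC projection of `v`. -/
def IsFractionLikeRates (v : A → A → ℝ) (φ : A → ℝ) : Prop :=
  ∃ w, IsCLCProjection v w ∧ IsStrengths w φ

end CLC

namespace CLC
variable {A : Type*}

/-! ### Indirect scores -/

/-! The projection is unambiguous for three reasons. Strict dominance of indirect scores is
transitive, so it extends to a total order. The constraint set of the turnouts is convex, closed and
nonempty, so the nearest point exists and is unique. Any two admissible orders are joined by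
exchanges of neighbours with zero indirect margin. For such a pair every compatible turnout matrix
has equal rows off the pair, so the exchange alters neither the constraint set nor the scores
(`IsAdmissible.projection_swap`, `IsAdmissible.projection_eq`).

The projection is continuous because there are finitely many orders: along an ultrafilter the order
is eventually constant, the turnouts converge by compactness, and their limit is again a projection
(`IsIntermediateTurnout.of_tendsto`). Uniqueness then identifies it.

For non-vanishing `v` the first option of the order has positive projected score over every other
one (`IsCLCProjection.exists_forall_pos`). Comparing two maximizing sequences with their geometric
mean (`likelihood_mul_le`) makes their limits proportional on each pair with a positive score, so
the first option ties all coordinates together and the limit is unique. Compactness of the simplex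
gives existence. Continuity holds because near-maximizers for matrices converging to `w₀` are
maximizing for `w₀` (`maximizing_of_tendsto`). -/

theorem exists_path_of_transGen {r : A → A → Prop} {x y : A} (h : Relation.TransGen r x y) :
    ∃ (n : ℕ) (p : Fin (n + 2) → A), p 0 = x ∧ p (Fin.last (n + 1)) = y ∧
      ∀ i : Fin (n + 1), r (p i.castSucc) (p i.succ) := by
  induction h using Relation.TransGen.head_induction_on with
  | @single a h =>
    refine ⟨0, ![a, y], rfl, rfl, fun i => ?_⟩
    fin_cases i
    simpa using h
  | @head a b hab _ ih =>
    obtain ⟨n, p, h0, h1, h2⟩ := ih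
    refine ⟨n + 1, Fin.cons a p, rfl, ?_, fun i => ?_⟩
    · rw [← Fin.succ_last, Fin.cons_succ, h1]
    · induction i using Fin.cases with
      | zero => simpa [h0] using hab
      | succ j => rw [← Fin.succ_castSucc, Fin.cons_succ, Fin.cons_succ]; exact h2 j

theorem transGen_of_path {r : A → A → Prop} {n : ℕ} {p : Fin (n + 2) → A}
    (h : ∀ i : Fin (n + 1), r (p i.castSucc) (p i.succ)) :
    Relation.TransGen r (p 0) (p (Fin.last (n + 1))) := by
  have key : ∀ i : Fin (n + 1), Relation.TransGen r (p 0) (p i.succ) := by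
    intro i
    induction i using Fin.induction with
    | zero => exact Relation.TransGen.single (h 0)
    | succ i ih =>
      refine ih.tail ?_
      have := h i.succ
      rwa [← Fin.succ_castSucc] at this
  have := key (Fin.last n)
  rwa [Fin.succ_last] at this

theorem IsLlull.mem_Icc' {v : A → A → ℝ} (hv : IsLlull v) (x y : A) : v x y ∈ Icc (0 : ℝ) 1 := by
  by_cases h : x = y
  · subst h; simp [hv.diag]
  · exact hv.mem_Icc x y h

variable [Fintype A]

theorem finite_pathScores (v : A → A → ℝ) (x y : A) :
    {s | ∃ (n : ℕ) (p : Fin (n + 2) → A), p 0 = x ∧ p (Fin.last (n + 1)) = y ∧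
    (∀ i : Fin (n + 1), p i.castSucc ≠ p i.succ) ∧
    s = ⨅ i : Fin (n + 1), v (p i.castSucc) (p i.succ)}.Finite := by
  refine (Set.finite_range (fun a : A × A => v a.1 a.2)).subset ?_
  rintro s ⟨n, p, -, -, -, rfl⟩
  obtain ⟨i, hi⟩ := exists_eq_ciInf_of_finite (f := fun i : Fin (n + 1) => v (p i.castSucc) (p i.succ))
  exact ⟨(_, _), hi⟩

theorem indirectScore_mem (v : A → A → ℝ) {x y : A} (hxy : x ≠ y) :
    ∃ (n : ℕ) (p : Fin (n + 2) → A), p 0 = x ∧ p (Fin.last (n + 1)) = y ∧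
    (∀ i : Fin (n + 1), p i.castSucc ≠ p i.succ) ∧
    indirectScore v x y = ⨅ i : Fin (n + 1), v (p i.castSucc) (p i.succ) := by
  refine Set.Nonempty.csSup_mem ?_ (finite_pathScores v x y)
  obtain ⟨n, p, h0, h1, h2⟩ := exists_path_of_transGen (Relation.TransGen.single hxy)
  exact ⟨_, n, p, h0, h1, h2, rfl⟩

/-- The maximum over paths is attained, since path scores lie among the finitely many entries of
`v`. This reduces statements about paths to transitive closures. -/
theorem le_indirectScore_iff (v : A → A → ℝ) {x y : A} (hxy : x ≠ y) (c : ℝ) :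
    c ≤ indirectScore v x y ↔ Relation.TransGen (fun a b => a ≠ b ∧ c ≤ v a b) x y := by
  constructor
  · intro h
    obtain ⟨n, p, h0, h1, h2, h3⟩ := indirectScore_mem v hxy
    rw [h3] at h
    rw [← h0, ← h1]
    exact transGen_of_path fun i => ⟨h2 i, h.trans (ciInf_le (Set.finite_range _).bddBelow i)⟩
  · intro h
    obtain ⟨n, p, h0, h1, h2⟩ := exists_path_of_transGen h
    exact (le_ciInf fun i => (h2 i).2).trans (le_csSup (finite_pathScores v x y).bddAbove
      ⟨n, p, h0, h1, fun i => (h2 i).1, rfl⟩)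

theorem IsLlull.indirectScore_mem_Icc {v : A → A → ℝ} (hv : IsLlull v) {x y : A} (hxy : x ≠ y) :
    indirectScore v x y ∈ Icc (0 : ℝ) 1 := by
  obtain ⟨n, p, -, -, -, h3⟩ := indirectScore_mem v hxy
  rw [h3]
  obtain ⟨i, hi⟩ := exists_eq_ciInf_of_finite (f := fun i : Fin (n + 1) => v (p i.castSucc) (p i.succ))
  rw [← hi]
  exact hv.mem_Icc' _ _

theorem min_indirectScore_le (v : A → A → ℝ) {x y z : A} (hxy : x ≠ y) (hyz : y ≠ z)
    (hxz : x ≠ z) :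
    min (indirectScore v x y) (indirectScore v y z) ≤ indirectScore v x z := by
  rw [le_indirectScore_iff v hxz]
  exact ((le_indirectScore_iff v hxy _).1 (min_le_left _ _)).trans
    ((le_indirectScore_iff v hyz _).1 (min_le_right _ _))

/-- The max-min triangle inequality is applied to `x z`, `y x` and `z y`, each through the third
option. Whichever term is the smaller one in each, linear arithmetic finishes. -/
theorem indirectScore_lt_trans (v : A → A → ℝ) {x y z : A}
    (h1 : indirectScore v y x < indirectScore v x y)
    (h2 : indirectScore v z y < indirectScore v y z) :
    indirectScore v z x < indirectScore v x z := by
  have hxy : x ≠ y := by rintro rfl; exact lt_irrefl _ h1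
  have hyz : y ≠ z := by rintro rfl; exact lt_irrefl _ h2
  have hxz : x ≠ z := by rintro rfl; exact lt_asymm h1 h2
  have a := min_indirectScore_le v hxy hyz hxz
  have b := min_indirectScore_le v hyz hxz.symm hxy.symm
  have c := min_indirectScore_le v hxz.symm hxy hyz.symm
  rcases min_le_iff.1 a with a | a <;> rcases min_le_iff.1 b with b | b <;>
    rcases min_le_iff.1 c with c | c <;> linarith

theorem indirectScore_le_add (v w : A → A → ℝ) {x y : A} (hxy : x ≠ y) {ε : ℝ}
    (h : ∀ a b, v a b ≤ w a b + ε) : indirectScore v x y ≤ indirectScore w x y + ε := by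
  rw [← sub_le_iff_le_add, le_indirectScore_iff w hxy]
  refine Relation.TransGen.mono (fun a b hab => ⟨hab.1, ?_⟩) _ _
    ((le_indirectScore_iff v hxy _).1 le_rfl)
  linarith [h a b, hab.2]

theorem continuous_indirectScore {x y : A} (hxy : x ≠ y) :
    Continuous fun v : A → A → ℝ => indirectScore v x y := by
  refine LipschitzWith.continuous (K := 1) (LipschitzWith.of_dist_le_mul fun v w => ?_)
  have h : ∀ a b, |v a b - w a b| ≤ dist v w := fun a b =>
    (dist_le_pi_dist (v a) (w a) b).trans (dist_le_pi_dist v w a)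
  rw [NNReal.coe_one, one_mul, Real.dist_eq, abs_le]
  constructor
  · have := indirectScore_le_add w v hxy (ε := dist v w)
      fun a b => by linarith [(abs_le.1 (h a b)).1]
    linarith
  · have := indirectScore_le_add v w hxy (ε := dist v w)
      fun a b => by linarith [(abs_le.1 (h a b)).2]
    linarith

theorem continuous_indirectMargin (x y : A) :
    Continuous fun v : A → A → ℝ => indirectMargin v x y := by
  by_cases hxy : x = y
  · subst hxy; simpa [indirectMargin] using continuous_const
  · exact (continuous_indirectScore hxy).sub (continuous_indirectScore (Ne.symm hxy))

/-! ### Admissible orders -/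

/-- Strict dominance is a strict partial order; a linear extension of it, enumerated increasingly,
is admissible. -/
theorem exists_isAdmissible (v : A → A → ℝ) : ∃ ξ : Ranking A, IsAdmissible v ξ := by
  let _ : PartialOrder A :=
    { le := fun x y => x = y ∨ indirectScore v y x < indirectScore v x y
      le_refl := fun x => Or.inl rfl
      le_trans := by
        rintro x y z (rfl | h1) (rfl | h2)
        · exact Or.inl rfl
        · exact Or.inr h2
        · exact Or.inr h1
        · exact Or.inr (indirectScore_lt_trans v h1 h2)
      le_antisymm := by
        rintro x y (h | h1) (h' | h2)
        · exact h
        · exact h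
        · exact h'.symm
        · exact absurd h2 (lt_asymm h1) }
  let _ : Fintype (LinearExtension A) := ‹Fintype A›
  let e : Fin (Fintype.card A) ≃o LinearExtension A := monoEquivOfFin (LinearExtension A) rfl
  refine ⟨e.symm.toEquiv, fun x y h => ?_⟩
  have hne : x ≠ y := by rintro rfl; exact lt_irrefl _ h
  have hle : (toLinearExtension x : LinearExtension A) ≤ toLinearExtension y :=
    toLinearExtension.monotone (Or.inr h)
  exact lt_of_le_of_ne (e.symm.monotone hle) fun h => hne (e.symm.injective h)

/-! ### Signs and bounds of the margins along an admissible order. -/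

theorem IsAdmissible.indirectMargin_nonneg {v : A → A → ℝ} {ξ : Ranking A} (h : IsAdmissible v ξ)
    {x y : A} (hxy : ξ x < ξ y) : 0 ≤ indirectMargin v x y := by
  by_contra hc
  exact lt_asymm hxy (h y x (by unfold indirectMargin at hc; linarith))

theorem finite_intermediateMargin (v : A → A → ℝ) (ξ : Ranking A) (x y : A) :
    {m | ∃ p q, ξ p ≤ ξ x ∧ ξ y ≤ ξ q ∧ m = indirectMargin v p q}.Finite := by
  refine (Set.finite_range (fun a : A × A => indirectMargin v a.1 a.2)).subset ?_
  rintro s ⟨p, q, -, -, rfl⟩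
  exact ⟨(p, q), rfl⟩

theorem intermediateMargin_le (v : A → A → ℝ) (ξ : Ranking A) {x y p q : A} (hp : ξ p ≤ ξ x)
    (hq : ξ y ≤ ξ q) : intermediateMargin v ξ x y ≤ indirectMargin v p q :=
  csInf_le (finite_intermediateMargin v ξ x y).bddBelow ⟨p, q, hp, hq, rfl⟩

theorem IsAdmissible.intermediateMargin_nonneg {v : A → A → ℝ} {ξ : Ranking A}
    (h : IsAdmissible v ξ) {x y : A} (hxy : ξ x < ξ y) : 0 ≤ intermediateMargin v ξ x y := by
  refine le_csInf ⟨_, x, y, le_rfl, le_rfl, rfl⟩ ?_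
  rintro _ ⟨p, q, hp, hq, rfl⟩
  exact h.indirectMargin_nonneg (lt_of_le_of_lt hp (lt_of_lt_of_le hxy hq))

theorem IsLlull.intermediateMargin_le_one {v : A → A → ℝ} (hv : IsLlull v) (ξ : Ranking A)
    {x y : A} (hxy : ξ x < ξ y) : intermediateMargin v ξ x y ≤ 1 := by
  refine (intermediateMargin_le v ξ le_rfl le_rfl).trans ?_
  have hne : x ≠ y := by rintro rfl; exact lt_irrefl _ hxy
  have := (hv.indirectScore_mem_Icc hne).2
  have := (hv.indirectScore_mem_Icc hne.symm).1
  unfold indirectMargin; linarith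

theorem Ranking.Next.lt {ξ : Ranking A} {x y : A} (h : ξ.Next x y) : ξ x < ξ y := by
  unfold Ranking.Next at h
  rw [Fin.lt_def]; omega

theorem Ranking.Next.ne {ξ : Ranking A} {x y : A} (h : ξ.Next x y) : x ≠ y := by
  rintro rfl; exact lt_irrefl _ h.lt

theorem Ranking.exists_next {ξ : Ranking A} {x y : A} (h : ξ x < ξ y) : ∃ x', ξ.Next x x' := by
  rw [Fin.lt_def] at h
  exact ⟨ξ.symm ⟨ξ x + 1, by omega⟩, by simp [Ranking.Next]⟩

theorem Ranking.exists_prev {ξ : Ranking A} {x y : A} (h : ξ x < ξ y) : ∃ y', ξ.Next y' y := by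
  rw [Fin.lt_def] at h
  refine ⟨ξ.symm ⟨ξ y - 1, by omega⟩, ?_⟩
  simp only [Ranking.Next, Equiv.apply_symm_apply]; omega

end CLC

namespace CLC

/-! ### Continuity of finite extrema -/

theorem tendsto_sSup_of_finite {ι J : Type*} [Finite J] (P : J → Prop) {f : ι → J → ℝ} {g : J → ℝ}
    {l : Filter ι} (h : ∀ j, P j → Tendsto (fun i => f i j) l (𝓝 (g j))) :
    Tendsto (fun i => sSup {s | ∃ j, P j ∧ s = f i j}) l (𝓝 (sSup {s | ∃ j, P j ∧ s = g j})) := by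
  classical
  have := Fintype.ofFinite J
  have key : ∀ k : J → ℝ, {s | ∃ j, P j ∧ s = k j} = k '' (Finset.univ.filter P : Finset J) := by
    intro k; ext s; simp [eq_comm]
  rcases (Finset.univ.filter P).eq_empty_or_nonempty with h0 | h0
  · simp only [key, h0, Finset.coe_empty, image_empty]
    exact tendsto_const_nhds
  · simp only [key, ← Finset.sup'_eq_csSup_image _ h0]
    exact Tendsto.finset_sup'_nhds_apply (f := fun j i => f i j) h0
      fun j hj => h j (Finset.mem_filter.1 hj).2

theorem tendsto_sInf_of_finite {ι J : Type*} [Finite J] (P : J → Prop) {f : ι → J → ℝ} {g : J → ℝ}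
    {l : Filter ι} (h : ∀ j, P j → Tendsto (fun i => f i j) l (𝓝 (g j))) :
    Tendsto (fun i => sInf {s | ∃ j, P j ∧ s = f i j}) l (𝓝 (sInf {s | ∃ j, P j ∧ s = g j})) := by
  classical
  have := Fintype.ofFinite J
  have key : ∀ k : J → ℝ, {s | ∃ j, P j ∧ s = k j} = k '' (Finset.univ.filter P : Finset J) := by
    intro k; ext s; simp [eq_comm]
  rcases (Finset.univ.filter P).eq_empty_or_nonempty with h0 | h0
  · simp only [key, h0, Finset.coe_empty, image_empty]
    exact tendsto_const_nhds
  · simp only [key, ← Finset.inf'_eq_csInf_image _ h0]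
    exact Tendsto.finset_inf'_nhds_apply (f := fun j i => f i j) h0
      fun j hj => h j (Finset.mem_filter.1 hj).2

variable {A : Type*}

theorem isCompact_bounded (B : ℝ) : IsCompact {τ : A → A → ℝ | ∀ x y, |τ x y| ≤ B} := by
  have : {τ : A → A → ℝ | ∀ x y, |τ x y| ≤ B} =
      Set.pi univ fun _ : A => Set.pi univ fun _ : A => Icc (-B) B := by
    ext τ; simp [abs_le, Pi.le_def, forall_and]
  rw [this]
  exact isCompact_univ_pi fun _ => isCompact_univ_pi fun _ => isCompact_Icc

theorem IsLlull.turnout_mem {v : A → A → ℝ} (hv : IsLlull v) {x y : A} (h : x ≠ y) :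
    turnout v x y ∈ Icc (0 : ℝ) 1 :=
  ⟨add_nonneg (hv.mem_Icc x y h).1 (hv.mem_Icc y x h.symm).1, hv.add_le_one x y h⟩

open scoped Classical in
/-- The turnouts that take the same value `c` on every pair of different options. -/
noncomputable def constTurnout (c : ℝ) (x y : A) : ℝ := if x = y then 0 else c

theorem constTurnout_of_ne (c : ℝ) {x y : A} (h : x ≠ y) : constTurnout c x y = c := by
  simp [constTurnout, h]

theorem constTurnout_comm (c : ℝ) (x y : A) : constTurnout c x y = constTurnout c y x := by
  by_cases h : x = y
  · rw [h]
  · rw [constTurnout_of_ne c h, constTurnout_of_ne c (Ne.symm h)]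

variable [Fintype A]

theorem continuous_intermediateMargin (ξ : Ranking A) (x y : A) :
    Continuous fun v : A → A → ℝ => intermediateMargin v ξ x y := by
  rw [continuous_iff_continuousAt]
  intro v
  have := tendsto_sInf_of_finite (J := A × A) (fun j => ξ j.1 ≤ ξ x ∧ ξ y ≤ ξ j.2)
    (f := fun (v : A → A → ℝ) j => indirectMargin v j.1 j.2) (l := 𝓝 v)
    fun j _ => (continuous_indirectMargin j.1 j.2).tendsto v
  simp only [Prod.exists, and_assoc] at this
  exact this

theorem tendsto_scoresOfConsecutive {ι : Type*} {l : Filter ι} (ξ : Ranking A)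
    {m τ : ι → A → A → ℝ} {m₀ τ₀ : A → A → ℝ}
    (hm : ∀ x y, Tendsto (fun i => m i x y) l (𝓝 (m₀ x y)))
    (hτ : ∀ x y, Tendsto (fun i => τ i x y) l (𝓝 (τ₀ x y))) (x y : A) :
    Tendsto (fun i => scoresOfConsecutive ξ (m i) (τ i) x y) l
      (𝓝 (scoresOfConsecutive ξ m₀ τ₀ x y)) := by
  unfold scoresOfConsecutive
  split_ifs
  · have := tendsto_sSup_of_finite (J := A × A)
      (fun j => ξ.Next j.1 j.2 ∧ ξ x ≤ ξ j.1 ∧ ξ j.2 ≤ ξ y)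
      (f := fun i j => (τ i j.1 j.2 + m i j.1 j.2) / 2) (l := l)
      fun j _ => ((hτ j.1 j.2).add (hm j.1 j.2)).div_const 2
    simpa only [Prod.exists, and_assoc] using this
  · have := tendsto_sInf_of_finite (J := A × A)
      (fun j => ξ.Next j.1 j.2 ∧ ξ y ≤ ξ j.1 ∧ ξ j.2 ≤ ξ x)
      (f := fun i j => (τ i j.1 j.2 - m i j.1 j.2) / 2) (l := l)
      fun j _ => ((hτ j.1 j.2).sub (hm j.1 j.2)).div_const 2
    simpa only [Prod.exists, and_assoc] using this
  · exact tendsto_const_nhds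

/-! ### The set of compatible turnouts -/

/-- With `c = 1` this makes the constraint set nonempty; with `c` the mean turnout it supplies the
competitor in `IsIntermediateTurnout.first_pos`. -/
theorem isCompatibleTurnout_constTurnout {ξ : Ranking A} {m : A → A → ℝ} {c : ℝ} (hc : c ≤ 1)
    (h0 : ∀ x x', ξ.Next x x' → 0 ≤ m x x') (h1 : ∀ x x', ξ.Next x x' → m x x' ≤ c) :
    IsCompatibleTurnout ξ m (constTurnout c) where
  diag x := by simp [constTurnout]
  symm x y := constTurnout_comm c x y
  bounds x x' h := by rw [constTurnout_of_ne c h.ne]; exact ⟨h1 x x' h, hc⟩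
  diff x x' z h hz hz' := by
    rw [constTurnout_of_ne c hz.symm, constTurnout_of_ne c hz'.symm, sub_self]
    exact ⟨le_rfl, h0 x x' h⟩

theorem IsCompatibleTurnout.convex {ξ : Ranking A} {m τ τ' : A → A → ℝ}
    (h : IsCompatibleTurnout ξ m τ) (h' : IsCompatibleTurnout ξ m τ') :
    IsCompatibleTurnout ξ m (fun x y => (τ x y + τ' x y) / 2) where
  diag x := by simp [h.diag, h'.diag]
  symm x y := by rw [h.symm x y, h'.symm x y]
  bounds x x' hx := by
    have := h.bounds x x' hx
    have := h'.bounds x x' hx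
    constructor <;> linarith
  diff x x' z hx hz hz' := by
    have := h.diff x x' z hx hz hz'
    have := h'.diff x x' z hx hz hz'
    constructor <;> linarith

theorem IsCompatibleTurnout.of_tendsto {ι : Type*} {l : Filter ι} [l.NeBot] {ξ : Ranking A}
    {m τ : ι → A → A → ℝ} {m₀ τ₀ : A → A → ℝ}
    (hm : ∀ x y, Tendsto (fun i => m i x y) l (𝓝 (m₀ x y)))
    (hτ : ∀ x y, Tendsto (fun i => τ i x y) l (𝓝 (τ₀ x y)))
    (h : ∀ᶠ i in l, IsCompatibleTurnout ξ (m i) (τ i)) : IsCompatibleTurnout ξ m₀ τ₀ where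
  diag x := tendsto_nhds_unique (hτ x x)
    (tendsto_const_nhds.congr' (h.mono fun _ hi => (hi.diag x).symm))
  symm x y := tendsto_nhds_unique (hτ x y)
    ((hτ y x).congr' (h.mono fun _ hi => (hi.symm x y).symm))
  bounds x x' hx := ⟨le_of_tendsto_of_tendsto (hm x x') (hτ x x')
      (h.mono fun _ hi => (hi.bounds x x' hx).1),
    le_of_tendsto (hτ x x') (h.mono fun _ hi => (hi.bounds x x' hx).2)⟩
  diff x x' z hx hz hz' := ⟨ge_of_tendsto ((hτ x z).sub (hτ x' z))
      (h.mono fun _ hi => (hi.diff x x' z hx hz hz').1),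
    le_of_tendsto_of_tendsto ((hτ x z).sub (hτ x' z)) (hm x x')
      (h.mono fun _ hi => (hi.diff x x' z hx hz hz').2)⟩

/-- Compatible turnouts, after contraction towards the constant `1`, remain compatible when the
margins are slightly perturbed. -/
theorem IsCompatibleTurnout.eventually_contract {ι : Type*} {l : Filter ι} {ξ : Ranking A}
    {m : ι → A → A → ℝ} {m₀ τ : A → A → ℝ}
    (hm : ∀ x y, Tendsto (fun i => m i x y) l (𝓝 (m₀ x y)))
    (h : IsCompatibleTurnout ξ m₀ τ)
    (hm0 : ∀ᶠ i in l, ∀ x x', ξ.Next x x' → 0 ≤ m i x x')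
    (hm1 : ∀ᶠ i in l, ∀ x x', ξ.Next x x' → m i x x' ≤ 1)
    (h0 : ∀ x x', ξ.Next x x' → 0 ≤ m₀ x x')
    {c : ℝ} (hc0 : 0 < c) (hc1 : c ≤ 1) :
    ∀ᶠ i in l, IsCompatibleTurnout ξ (m i) (fun x y => (1 - c) * τ x y + c * constTurnout 1 x y) := by
  -- Contraction leaves strict room in these bounds, except in the lower one where `m₀ = 0` and in
  -- the upper one where `m₀ = 1`; there `0 ≤ m i` and `m i ≤ 1` take over.
  have key : ∀ᶠ i in l, ∀ x x', ξ.Next x x' →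
      (1 - c) * m₀ x x' ≤ m i x x' ∧ m i x x' ≤ (1 - c) * m₀ x x' + c := by
    rw [eventually_all]; intro x
    rw [eventually_all]; intro x'
    by_cases hx : ξ.Next x x'
    · have e1 : ∀ᶠ i in l, (1 - c) * m₀ x x' ≤ m i x x' := by
        rcases (h0 x x' hx).eq_or_lt with e | e
        · filter_upwards [hm0] with i hi
          rw [← e, mul_zero]; exact hi x x' hx
        · exact (hm x x').eventually (eventually_ge_nhds (by nlinarith))
      have e2 : ∀ᶠ i in l, m i x x' ≤ (1 - c) * m₀ x x' + c := by
        have hle : m₀ x x' ≤ 1 := (h.bounds x x' hx).1.trans (h.bounds x x' hx).2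
        rcases hle.eq_or_lt with e | e
        · filter_upwards [hm1] with i hi
          rw [e]; linarith [hi x x' hx]
        · exact (hm x x').eventually (eventually_le_nhds (by nlinarith))
      filter_upwards [e1, e2] with i h1 h2 _ using ⟨h1, h2⟩
    · exact Eventually.of_forall fun i h => absurd h hx
  filter_upwards [key, hm0] with i hi hi0
  refine ⟨fun x => ?_, fun x y => ?_, fun x x' hx => ?_, fun x x' z hx hz hz' => ?_⟩
  · simp [h.diag, constTurnout]
  · rw [h.symm x y, constTurnout_comm]
  · have a := h.bounds x x' hx
    have b := hi x x' hx
    rw [constTurnout_of_ne _ hx.ne]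
    constructor <;> nlinarith
  · have a := h.diff x x' z hx hz hz'
    have b := hi x x' hx
    rw [constTurnout_of_ne _ hz.symm, constTurnout_of_ne _ hz'.symm]
    constructor <;> nlinarith

/-! ### The projection of the turnouts -/

open scoped Classical in
/-- The square of the Euclidean distance from `τ` to the turnouts of `v`. -/
noncomputable def turnoutDist (v τ : A → A → ℝ) : ℝ :=
  ∑ x, ∑ y with y ≠ x, (τ x y - turnout v x y) ^ 2

open scoped Classical in
theorem turnoutDist_eq (v τ : A → A → ℝ) :
    turnoutDist v τ = ∑ p : A × A with p.2 ≠ p.1, (τ p.1 p.2 - turnout v p.1 p.2) ^ 2 := by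
  simp only [turnoutDist, Finset.sum_filter, Fintype.sum_prod_type]

theorem tendsto_turnoutDist {ι : Type*} {l : Filter ι} {v τ : ι → A → A → ℝ} {v₀ τ₀ : A → A → ℝ}
    (hv : ∀ x y, Tendsto (fun i => v i x y) l (𝓝 (v₀ x y)))
    (hτ : ∀ x y, Tendsto (fun i => τ i x y) l (𝓝 (τ₀ x y))) :
    Tendsto (fun i => turnoutDist (v i) (τ i)) l (𝓝 (turnoutDist v₀ τ₀)) := by
  unfold turnoutDist turnout
  exact tendsto_finsetSum _ fun x _ => tendsto_finsetSum _ fun y _ =>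
    ((hτ x y).sub ((hv x y).add (hv y x))).pow 2

/-- The bound depends on neither `v` nor the order, so it gives compactness both for one projection
and for a varying family of them. -/
theorem IsLlull.abs_le_of_turnoutDist_le {v τ : A → A → ℝ} (hv : IsLlull v) (hd : ∀ x, τ x x = 0)
    (h : turnoutDist v τ ≤ turnoutDist v (constTurnout 1)) (x y : A) :
    |τ x y| ≤ Fintype.card (A × A) + 2 := by
  classical
  have hN : (0 : ℝ) ≤ Fintype.card (A × A) := Nat.cast_nonneg _
  by_cases hxy : x = y
  · subst hxy; rw [hd, abs_zero]; positivity
  have h1 : turnoutDist v (constTurnout 1) ≤ Fintype.card (A × A) := by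
    rw [turnoutDist_eq]
    calc _ ≤ ∑ p : A × A with p.2 ≠ p.1, (1 : ℝ) := by
          refine Finset.sum_le_sum fun p hp => ?_
          have hp' := (Finset.mem_filter.1 hp).2
          have := hv.turnout_mem hp'.symm
          rw [constTurnout_of_ne _ hp'.symm]
          nlinarith [this.1, this.2]
      _ ≤ _ := by
          rw [Finset.sum_const, nsmul_eq_mul, mul_one]
          exact_mod_cast Finset.card_le_univ _
  have h2 : (τ x y - turnout v x y) ^ 2 ≤ turnoutDist v τ := by
    rw [turnoutDist_eq]
    exact Finset.single_le_sum (f := fun p : A × A => (τ p.1 p.2 - turnout v p.1 p.2) ^ 2)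
      (a := (x, y)) (fun p _ => sq_nonneg _) (by simp [Ne.symm hxy])
  have h3 := hv.turnout_mem hxy
  -- The squared deviation is at most the number `N` of pairs, hence at most `(N + 1) ^ 2`.
  have h4 : |τ x y - turnout v x y| ≤ Fintype.card (A × A) + 1 :=
    abs_le_of_sq_le_sq (by nlinarith) (by positivity)
  rw [abs_le] at h4 ⊢
  constructor <;> linarith [h3.1, h3.2, h4.1, h4.2]

theorem isCompatible_one {v : A → A → ℝ} (hv : IsLlull v) {ξ : Ranking A}
    (hξ : IsAdmissible v ξ) : IsCompatibleTurnout ξ (intermediateMargin v ξ) (constTurnout 1) :=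
  isCompatibleTurnout_constTurnout le_rfl (fun _ _ h => hξ.intermediateMargin_nonneg h.lt)
    (fun _ _ h => hv.intermediateMargin_le_one ξ h.lt)

theorem exists_isIntermediateTurnout {v : A → A → ℝ} (hv : IsLlull v) {ξ : Ranking A}
    (hξ : IsAdmissible v ξ) : ∃ τ, IsIntermediateTurnout v ξ τ := by
  have hone := isCompatible_one hv hξ
  set K : Set (A → A → ℝ) := {τ | IsCompatibleTurnout ξ (intermediateMargin v ξ) τ ∧
    turnoutDist v τ ≤ turnoutDist v (constTurnout 1)}
  have hcont : Continuous (turnoutDist v) := by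
    rw [continuous_iff_continuousAt]
    exact fun τ => tendsto_turnoutDist (fun _ _ => tendsto_const_nhds)
      fun x y => ((continuous_apply y).comp (continuous_apply x)).tendsto τ
  have hclosed : IsClosed K := by
    suffices IsClosed {τ | IsCompatibleTurnout ξ (intermediateMargin v ξ) τ} from
      this.inter (isClosed_le hcont continuous_const)
    rw [isClosed_iff_ultrafilter]
    intro τ u hu hmem
    exact IsCompatibleTurnout.of_tendsto (l := (u : Filter (A → A → ℝ))) (m := fun _ => intermediateMargin v ξ)
      (τ := fun τ => τ) (fun _ _ => tendsto_const_nhds)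
      (fun x y => (((continuous_apply y).comp (continuous_apply x)).tendsto τ).mono_left hu) hmem
  have hK : IsCompact K := (isCompact_bounded _).of_isClosed_subset hclosed
    fun τ h => hv.abs_le_of_turnoutDist_le h.1.diag h.2
  obtain ⟨τ, hτ, hmin⟩ := hK.exists_isMinOn ⟨_, hone, le_rfl⟩ hcont.continuousOn
  refine ⟨τ, hτ.1, fun τ' h' => ?_⟩
  change turnoutDist v τ ≤ turnoutDist v τ'
  by_cases hle : turnoutDist v τ' ≤ turnoutDist v (constTurnout 1)
  · exact hmin ⟨h', hle⟩
  · exact hτ.2.trans (not_le.1 hle).le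

/-- Parallelogram identity: the midpoint of two minimizers is compatible and cannot be nearer than
they are. -/
theorem IsIntermediateTurnout.unique {v τ τ' : A → A → ℝ} {ξ : Ranking A}
    (h : IsIntermediateTurnout v ξ τ) (h' : IsIntermediateTurnout v ξ τ') : τ = τ' := by
  classical
  have h1 : turnoutDist v τ ≤ turnoutDist v (fun x y => (τ x y + τ' x y) / 2) :=
    h.2 _ (h.1.convex h'.1)
  have h2 : turnoutDist v τ' ≤ turnoutDist v (fun x y => (τ x y + τ' x y) / 2) :=
    h'.2 _ (h.1.convex h'.1)
  have h3 : 4 * turnoutDist v (fun x y => (τ x y + τ' x y) / 2) +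
      ∑ p : A × A with p.2 ≠ p.1, (τ p.1 p.2 - τ' p.1 p.2) ^ 2 =
      2 * turnoutDist v τ + 2 * turnoutDist v τ' := by
    simp only [turnoutDist_eq, Finset.mul_sum, ← Finset.sum_add_distrib]
    exact Finset.sum_congr rfl fun p _ => by ring
  have h4 : ∑ p : A × A with p.2 ≠ p.1, (τ p.1 p.2 - τ' p.1 p.2) ^ 2 = 0 :=
    le_antisymm (by linarith) (Finset.sum_nonneg fun p _ => sq_nonneg _)
  rw [Finset.sum_eq_zero_iff_of_nonneg fun p _ => sq_nonneg _] at h4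
  ext x y
  by_cases hxy : x = y
  · subst hxy; rw [h.1.diag, h'.1.diag]
  · have := h4 (x, y) (by simp [Ne.symm hxy])
    exact sub_eq_zero.1 (pow_eq_zero_iff two_ne_zero |>.1 this)

/-- The constraint set moves with `v`, so a competitor at the limit need not be compatible nearby.
Contracted towards the constant `1` it eventually is. Distances are compared for fixed `c`, and then
`c` tends to `0`. -/
theorem IsIntermediateTurnout.of_tendsto {ι : Type*} {l : Filter ι} [l.NeBot] {ξ : Ranking A}
    {v τ : ι → A → A → ℝ} {v₀ τ₀ : A → A → ℝ} (hv : Tendsto v l (𝓝 v₀)) (hτ : Tendsto τ l (𝓝 τ₀))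
    (hL : ∀ i, IsLlull (v i)) (hξ₀ : IsAdmissible v₀ ξ)
    (hξ : ∀ᶠ i in l, IsAdmissible (v i) ξ) (h : ∀ᶠ i in l, IsIntermediateTurnout (v i) ξ (τ i)) :
    IsIntermediateTurnout v₀ ξ τ₀ := by
  have hm : ∀ x y, Tendsto (fun i => intermediateMargin (v i) ξ x y) l
      (𝓝 (intermediateMargin v₀ ξ x y)) :=
    fun x y => ((continuous_intermediateMargin ξ x y).tendsto v₀).comp hv
  have hv' : ∀ x y, Tendsto (fun i => v i x y) l (𝓝 (v₀ x y)) :=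
    fun x y => (tendsto_pi_nhds.1 (tendsto_pi_nhds.1 hv x)) y
  have hτ' : ∀ x y, Tendsto (fun i => τ i x y) l (𝓝 (τ₀ x y)) :=
    fun x y => (tendsto_pi_nhds.1 (tendsto_pi_nhds.1 hτ x)) y
  refine ⟨IsCompatibleTurnout.of_tendsto hm hτ' (h.mono fun i hi => hi.1), fun τ' h' => ?_⟩
  change turnoutDist v₀ τ₀ ≤ turnoutDist v₀ τ'
  have key : ∀ c : ℝ, 0 < c → c ≤ 1 → turnoutDist v₀ τ₀ ≤
      turnoutDist v₀ (fun x y => (1 - c) * τ' x y + c * constTurnout 1 x y) := by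
    intro c hc0 hc1
    have := h'.eventually_contract hm
      (hξ.mono fun i hi x x' hx => hi.intermediateMargin_nonneg hx.lt)
      (Eventually.of_forall fun i x x' hx => (hL i).intermediateMargin_le_one ξ hx.lt)
      (fun x x' hx => hξ₀.intermediateMargin_nonneg hx.lt) hc0 hc1
    refine le_of_tendsto_of_tendsto (tendsto_turnoutDist hv' hτ')
      (tendsto_turnoutDist hv' fun _ _ => tendsto_const_nhds) ?_
    filter_upwards [this, h] with i h1 h2 using h2.2 _ h1
  have hlim : Tendsto (fun c : ℝ =>
      turnoutDist v₀ (fun x y => (1 - c) * τ' x y + c * constTurnout 1 x y)) (𝓝[>] 0)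
      (𝓝 (turnoutDist v₀ τ')) := by
    refine tendsto_turnoutDist (fun _ _ => tendsto_const_nhds) fun x y => ?_
    have : Continuous fun c : ℝ => (1 - c) * τ' x y + c * constTurnout 1 x y := by fun_prop
    have := this.tendsto 0
    simp only [sub_zero, one_mul, zero_mul, add_zero] at this
    exact this.mono_left nhdsWithin_le_nhds
  refine ge_of_tendsto hlim ?_
  filter_upwards [Ioc_mem_nhdsGT (zero_lt_one (α := ℝ))] with c hc using key c hc.1 hc.2

/-- In contrapositive form, admissibility is a family of weak inequalities between continuous
functions. -/
theorem isClosed_isAdmissible (ξ : Ranking A) : IsClosed {v : A → A → ℝ | IsAdmissible v ξ} := by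
  have : {v : A → A → ℝ | IsAdmissible v ξ} =
      ⋂ x, ⋂ y, {v | ¬ ξ x < ξ y → indirectMargin v x y ≤ 0} := by
    ext v
    simp only [mem_ofPred_eq, mem_iInter, IsAdmissible, indirectMargin, sub_nonpos]
    exact forall₂_congr fun x y => by
      rw [not_imp_comm, not_le]
  rw [this]
  refine isClosed_iInter fun x => isClosed_iInter fun y => ?_
  by_cases h : ξ x < ξ y
  · simp [h]
  · simpa [h] using isClosed_le (continuous_indirectMargin x y) continuous_const

end CLC

namespace CLC
theorem symm_swap_invariant {A : Type*} [DecidableEq A] {S : A → A → ℝ} {x x' : A}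
    (h1 : ∀ z, z ≠ x → z ≠ x' → S x z = S x' z) (h2 : ∀ z, z ≠ x → z ≠ x' → S z x = S z x')
    (h3 : S x x = S x' x') (h4 : S x x' = S x' x) (a b : A) :
    S (Equiv.swap x x' a) (Equiv.swap x x' b) = S a b := by
  rw [Equiv.swap_apply_def, Equiv.swap_apply_def]
  split_ifs with ha hb hb' ha' hb hb' hb hb' <;> subst_vars <;> simp_all

variable {A : Type*} [Fintype A]

/-! ### Relabelling the options of a ranking -/

/-- The values that `f` takes on the pairs of consecutive options between `x` and `y`. -/
def cutSet (ξ : Ranking A) (f : A → A → ℝ) (x y : A) : Set ℝ :=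
  {s | ∃ p p', ξ.Next p p' ∧ ξ x ≤ ξ p ∧ ξ p' ≤ ξ y ∧ s = f p p'}

theorem scoresOfConsecutive_of_lt {ξ : Ranking A} (m τ : A → A → ℝ) {x y : A} (h : ξ x < ξ y) :
    scoresOfConsecutive ξ m τ x y = sSup (cutSet ξ (fun p q => (τ p q + m p q) / 2) x y) :=
  if_pos h

theorem scoresOfConsecutive_of_gt {ξ : Ranking A} (m τ : A → A → ℝ) {x y : A} (h : ξ y < ξ x) :
    scoresOfConsecutive ξ m τ x y = sInf (cutSet ξ (fun p q => (τ p q - m p q) / 2) y x) :=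
  (if_neg h.not_gt).trans (if_pos h)

theorem finite_cutSet (ξ : Ranking A) (f : A → A → ℝ) (x y : A) : (cutSet ξ f x y).Finite := by
  refine (Set.finite_range (fun a : A × A => f a.1 a.2)).subset ?_
  rintro s ⟨p, q, -, -, -, rfl⟩
  exact ⟨(p, q), rfl⟩

theorem Ranking.Next.le_iff {ξ : Ranking A} {x x' : A} (h : ξ.Next x x') (z : A) :
    ξ x' ≤ ξ z ↔ ξ x < ξ z := by
  unfold Ranking.Next at h
  rw [Fin.le_def, Fin.lt_def]; omega

theorem Ranking.Next.lt_iff {ξ : Ranking A} {x x' : A} (h : ξ.Next x x') (z : A) :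
    ξ z < ξ x' ↔ ξ z ≤ ξ x := by
  rw [← not_le, h.le_iff, not_lt]

theorem Ranking.Next.eq_left {ξ : Ranking A} {x y z : A} (h : ξ.Next x z) (h' : ξ.Next y z) :
    x = y := by
  unfold Ranking.Next at h h'
  exact ξ.injective (Fin.ext (by omega))

theorem Ranking.Next.eq_right {ξ : Ranking A} {x y z : A} (h : ξ.Next x y) (h' : ξ.Next x z) :
    y = z := by
  unfold Ranking.Next at h h'
  exact ξ.injective (Fin.ext (by omega))

theorem cutSet_left {ξ : Ranking A} (f : A → A → ℝ) {x x' y : A} (h : ξ.Next x x')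
    (hy : ξ x' ≤ ξ y) : cutSet ξ f x y = insert (f x x') (cutSet ξ f x' y) := by
  ext s
  constructor
  · rintro ⟨p, q, hpq, hp, hq, rfl⟩
    rcases hp.eq_or_lt with e | e
    · obtain rfl := ξ.injective e
      obtain rfl := h.eq_right hpq
      exact Or.inl rfl
    · exact Or.inr ⟨p, q, hpq, (h.le_iff p).2 e, hq, rfl⟩
  · rintro (rfl | ⟨p, q, hpq, hp, hq, rfl⟩)
    · exact ⟨x, x', h, le_rfl, hy, rfl⟩
    · exact ⟨p, q, hpq, h.lt.le.trans hp, hq, rfl⟩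

theorem cutSet_right {ξ : Ranking A} (f : A → A → ℝ) {x y y' : A} (h : ξ.Next y y')
    (hx : ξ x ≤ ξ y) : cutSet ξ f x y' = insert (f y y') (cutSet ξ f x y) := by
  ext s
  constructor
  · rintro ⟨p, q, hpq, hp, hq, rfl⟩
    rcases hq.eq_or_lt with e | e
    · obtain rfl := ξ.injective e
      obtain rfl := h.eq_left hpq
      exact Or.inl rfl
    · exact Or.inr ⟨p, q, hpq, hp, (h.lt_iff q).1 e, rfl⟩
  · rintro (rfl | ⟨p, q, hpq, hp, hq, rfl⟩)
    · exact ⟨y, y', h, hx, le_rfl, rfl⟩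
    · exact ⟨p, q, hpq, hp, hq.trans h.lt.le, rfl⟩

theorem sSup_insert_of_le {s : Set ℝ} (hs : s.Finite) {a b : ℝ} (hb : b ∈ s) (h : a ≤ b) :
    sSup (insert a s) = sSup s := by
  rw [csSup_insert hs.bddAbove ⟨b, hb⟩, sup_eq_right.2 (h.trans (le_csSup hs.bddAbove hb))]

theorem sInf_insert_of_ge {s : Set ℝ} (hs : s.Finite) {a b : ℝ} (hb : b ∈ s) (h : b ≤ a) :
    sInf (insert a s) = sInf s := by
  rw [csInf_insert hs.bddBelow ⟨b, hb⟩, inf_eq_right.2 ((csInf_le hs.bddBelow hb).trans h)]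

/-- The constraints involve margins of consecutive pairs only, so agreement of the margins there is
enough. -/
theorem isCompatibleTurnout_relabel {ξ : Ranking A} {σ : A ≃ A} {m m' τ : A → A → ℝ}
    (hm : ∀ p q, ξ.Next (σ p) (σ q) → m' p q = m (σ p) (σ q)) :
    IsCompatibleTurnout (σ.trans ξ : Ranking A) m' (fun a b => τ (σ a) (σ b)) ↔
      IsCompatibleTurnout ξ m τ := by
  constructor
  · intro h
    refine ⟨fun x => ?_, fun x y => ?_, fun x x' hx => ?_, fun x x' z hx hz hz' => ?_⟩
    all_goals obtain ⟨x, rfl⟩ := σ.surjective x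
    · exact h.diag x
    · obtain ⟨y, rfl⟩ := σ.surjective y
      exact h.symm x y
    · obtain ⟨x', rfl⟩ := σ.surjective x'
      rw [← hm x x' hx]
      exact h.bounds x x' hx
    · obtain ⟨x', rfl⟩ := σ.surjective x'
      obtain ⟨z, rfl⟩ := σ.surjective z
      rw [← hm x x' hx]
      exact h.diff x x' z hx (fun e => hz (by rw [e])) (fun e => hz' (by rw [e]))
  · intro h
    refine ⟨fun x => h.diag _, fun x y => h.symm _ _, fun x x' hx => ?_,
      fun x x' z hx hz hz' => ?_⟩
    · rw [hm x x' hx]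
      exact h.bounds _ _ hx
    · rw [hm x x' hx]
      exact h.diff _ _ _ hx (fun e => hz (σ.injective e)) (fun e => hz' (σ.injective e))

theorem cutSet_relabel {ξ : Ranking A} {σ : A ≃ A} {f f' : A → A → ℝ}
    (hf : ∀ p q, ξ.Next (σ p) (σ q) → f' p q = f (σ p) (σ q)) (x y : A) :
    cutSet (σ.trans ξ : Ranking A) f' x y = cutSet ξ f (σ x) (σ y) := by
  ext s
  constructor
  · rintro ⟨p, q, hpq, hp, hq, rfl⟩
    exact ⟨σ p, σ q, hpq, hp, hq, hf p q hpq⟩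
  · rintro ⟨p, q, hpq, hp, hq, rfl⟩
    obtain ⟨p, rfl⟩ := σ.surjective p
    obtain ⟨q, rfl⟩ := σ.surjective q
    exact ⟨p, q, hpq, hp, hq, (hf p q hpq).symm⟩

theorem scoresOfConsecutive_relabel {ξ : Ranking A} {σ : A ≃ A} {m m' τ : A → A → ℝ}
    (hm : ∀ p q, ξ.Next (σ p) (σ q) → m' p q = m (σ p) (σ q)) (x y : A) :
    scoresOfConsecutive (σ.trans ξ : Ranking A) m' (fun a b => τ (σ a) (σ b)) x y =
      scoresOfConsecutive ξ m τ (σ x) (σ y) := by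
  rcases lt_trichotomy (ξ (σ x)) (ξ (σ y)) with h | h | h
  · rw [scoresOfConsecutive_of_lt m τ h, scoresOfConsecutive_of_lt (ξ := (σ.trans ξ : Ranking A)) _ _ h,
      cutSet_relabel (f := fun p q => (τ p q + m p q) / 2) fun p q hpq => by rw [hm p q hpq]]
  · obtain rfl := σ.injective (ξ.injective h)
    simp [scoresOfConsecutive]
  · rw [scoresOfConsecutive_of_gt m τ h, scoresOfConsecutive_of_gt (ξ := (σ.trans ξ : Ranking A)) _ _ h,
      cutSet_relabel (f := fun p q => (τ p q - m p q) / 2) fun p q hpq => by rw [hm p q hpq]]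

/-! ### Exchanging two consecutive options whose margin vanishes -/

theorem IsAdmissible.intermediateMargin_eq_zero {v : A → A → ℝ} {ξ : Ranking A} (hξ : IsAdmissible v ξ) {p q : A}
    (h : ξ p < ξ q) (h0 : indirectMargin v p q = 0) : intermediateMargin v ξ p q = 0 :=
  le_antisymm (h0 ▸ intermediateMargin_le v ξ le_rfl le_rfl) (hξ.intermediateMargin_nonneg h)

/-- A zero margin squeezes the difference of the two rows between `0` and `0`. -/
theorem IsCompatibleTurnout.eq_of_next {ξ : Ranking A} {x x' : A} {m τ : A → A → ℝ} (hτ : IsCompatibleTurnout ξ m τ)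
    (h : ξ.Next x x') (h0 : m x x' = 0) {z : A} (hz : z ≠ x) (hz' : z ≠ x') : τ x z = τ x' z := by
  have := hτ.diff x x' z h hz hz'
  rw [h0] at this
  linarith [this.1, this.2]

section Swap

variable [DecidableEq A] {ξ : Ranking A} {x x' : A}

/-- The initial segment ending at `b` separates the neighbours `x` and `x'` only when `b = x`. -/
theorem Ranking.Next.swap_le_iff (h : ξ.Next x x') {b : A} (hb : b ≠ x) (a : A) :
    ξ (Equiv.swap x x' a) ≤ ξ b ↔ ξ a ≤ ξ b := by
  have hb' : ξ b ≠ ξ x := fun e => hb (ξ.injective e)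
  rw [Ne, Fin.ext_iff] at hb'
  unfold Ranking.Next at h
  rw [Equiv.swap_apply_def, Fin.le_def, Fin.le_def]
  split_ifs with h1 h2
  · subst h1; omega
  · subst h2; omega
  · rfl

theorem Ranking.Next.le_swap_iff (h : ξ.Next x x') {b : A} (hb : b ≠ x') (a : A) :
    ξ b ≤ ξ (Equiv.swap x x' a) ↔ ξ b ≤ ξ a := by
  have hb' : ξ b ≠ ξ x' := fun e => hb (ξ.injective e)
  rw [Ne, Fin.ext_iff] at hb'
  unfold Ranking.Next at h
  rw [Equiv.swap_apply_def, Fin.le_def, Fin.le_def]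
  split_ifs with h1 h2
  · subst h1; omega
  · subst h2; omega
  · rfl

theorem Ranking.Next.swap_lt_swap (h : ξ.Next x x') {p q : A} (hpq : ξ p < ξ q)
    (hne : ¬ (p = x ∧ q = x')) : ξ (Equiv.swap x x' p) < ξ (Equiv.swap x x' q) := by
  by_cases hp : p = x
  · subst hp
    have hq : q ≠ x' := fun e => hne ⟨rfl, e⟩
    have hq' : ξ q ≠ ξ x' := fun e => hq (ξ.injective e)
    have hq2 : q ≠ p := by rintro rfl; exact lt_irrefl _ hpq
    rw [Equiv.swap_apply_left, Equiv.swap_apply_of_ne_of_ne hq2 hq]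
    exact lt_of_le_of_ne ((h.le_iff q).2 hpq) hq'.symm
  · have : ¬ ξ (Equiv.swap x x' q) ≤ ξ p := by rw [h.swap_le_iff hp]; exact hpq.not_ge
    by_cases hp' : p = x'
    · subst hp'
      have hq2 : q ≠ p := by rintro rfl; exact lt_irrefl _ hpq
      have hq : q ≠ x := by rintro rfl; exact lt_asymm hpq h.lt
      rw [Equiv.swap_apply_right, Equiv.swap_apply_of_ne_of_ne hq hq2]
      exact h.lt.trans hpq
    · rw [Equiv.swap_apply_of_ne_of_ne hp hp']
      exact not_le.1 this

theorem IsAdmissible.swap {v : A → A → ℝ} (hξ : IsAdmissible v ξ) (h : ξ.Next x x')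
    (h0 : indirectMargin v x x' = 0) :
    IsAdmissible v ((Equiv.swap x x').trans ξ : Ranking A) := by
  intro p q hpq
  refine h.swap_lt_swap (hξ p q hpq) ?_
  rintro ⟨rfl, rfl⟩
  unfold indirectMargin at h0
  linarith

/-- At the exchanged pair both margins vanish; at any other consecutive pair the segments defining
the minimum are stable under the exchange. -/
theorem IsAdmissible.intermediateMargin_swap {v : A → A → ℝ} (hξ : IsAdmissible v ξ)
    (h : ξ.Next x x') (h0 : indirectMargin v x x' = 0) (p q : A)
    (hpq : ξ.Next (Equiv.swap x x' p) (Equiv.swap x x' q)) :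
    intermediateMargin v ((Equiv.swap x x').trans ξ : Ranking A) p q =
      intermediateMargin v ξ (Equiv.swap x x' p) (Equiv.swap x x' q) := by
  by_cases hp : Equiv.swap x x' p = x
  · have hq : Equiv.swap x x' q = x' := by rw [hp] at hpq; exact hpq.eq_right h
    have hp1 : p = x' := by rw [Equiv.swap_apply_eq_iff, Equiv.swap_apply_left] at hp; exact hp
    have hq1 : q = x := by rw [Equiv.swap_apply_eq_iff, Equiv.swap_apply_right] at hq; exact hq
    rw [hp, hq, hξ.intermediateMargin_eq_zero h.lt h0]
    refine (hξ.swap h h0).intermediateMargin_eq_zero hpq.lt ?_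
    rw [hp1, hq1, ← neg_zero, ← h0]
    simp [indirectMargin]
  · have hq : Equiv.swap x x' q ≠ x' := by
      intro e; rw [e] at hpq; exact hp (hpq.eq_left h)
    unfold intermediateMargin
    simp only [Equiv.trans_apply, h.swap_le_iff hp, h.le_swap_iff hq]

theorem IsCompatibleTurnout.swap_eq {m τ : A → A → ℝ} (hτ : IsCompatibleTurnout ξ m τ)
    (h : ξ.Next x x') (h0 : m x x' = 0) :
    (fun a b => τ (Equiv.swap x x' a) (Equiv.swap x x' b)) = τ := by
  ext a b
  refine symm_swap_invariant (fun z hz hz' => hτ.eq_of_next h h0 hz hz') (fun z hz hz' => ?_)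
    (by rw [hτ.diag, hτ.diag]) (hτ.symm _ _) a b
  rw [hτ.symm z x, hτ.symm z x']
  exact hτ.eq_of_next h h0 hz hz'

/-- The interval of `x x'` degenerates to the point `τ x x' / 2`, which lies in the intervals of the
neighbouring consecutive pairs. Including it or not changes no maximum or minimum. -/
theorem IsCompatibleTurnout.scores_swap {m τ : A → A → ℝ} (hτ : IsCompatibleTurnout ξ m τ)
    (hm : ∀ p q, ξ.Next p q → 0 ≤ m p q) (h : ξ.Next x x') (h0 : m x x' = 0) (a b : A) :
    scoresOfConsecutive ξ m τ (Equiv.swap x x' a) (Equiv.swap x x' b) =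
      scoresOfConsecutive ξ m τ a b := by
  -- The next pair `x' c` satisfies `τ x c = τ x' c`, so the difference constraint with third option
  -- `x` places `τ x x'` between `τ x' c` and `τ x' c + m x' c`.
  have after : ∀ z, ξ x' < ξ z → ∃ c, ξ.Next x' c ∧ ξ c ≤ ξ z ∧
      τ x x' ≤ τ x' c + m x' c ∧ τ x' c - m x' c ≤ τ x x' := by
    intro z hz
    obtain ⟨c, hc⟩ := Ranking.exists_next hz
    have hcx : c ≠ x := by rintro rfl; exact lt_asymm hc.lt h.lt
    have e1 := hτ.diff x' c x hc h.ne hcx.symm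
    have e2 := hτ.eq_of_next h h0 hcx hc.ne.symm
    rw [hτ.symm c x, e2, hτ.symm x' x] at e1
    have := hm _ _ hc
    exact ⟨c, hc, (hc.le_iff z).2 hz, by linarith [e1.2], by linarith [e1.1]⟩
  have before : ∀ z, ξ z < ξ x → ∃ c, ξ.Next c x ∧ ξ z ≤ ξ c ∧
      τ x x' ≤ τ c x + m c x ∧ τ c x - m c x ≤ τ x x' := by
    intro z hz
    obtain ⟨c, hc⟩ := Ranking.exists_prev hz
    have hcx : c ≠ x' := by rintro rfl; exact lt_asymm hc.lt h.lt
    have e1 := hτ.diff c x x' hc hcx.symm h.ne.symm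
    have e2 := hτ.eq_of_next h h0 hc.ne hcx
    rw [hτ.symm c x', ← e2, hτ.symm x c] at e1
    have := hm _ _ hc
    exact ⟨c, hc, (hc.lt_iff z).1 hz, by linarith [e1.1], by linarith [e1.2]⟩
  have cases : ∀ z, z ≠ x → z ≠ x' → ξ x' < ξ z ∨ ξ z < ξ x := by
    intro z hz hz'
    rcases lt_trichotomy (ξ z) (ξ x) with e | e | e
    · exact Or.inr e
    · exact absurd (ξ.injective e) hz
    · exact Or.inl (lt_of_le_of_ne ((h.le_iff z).2 e) fun e => hz' (ξ.injective e).symm)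
  refine symm_swap_invariant ?_ ?_ (by simp [scoresOfConsecutive]) ?_ a b
  · intro z hz hz'
    rcases cases z hz hz' with e | e
    · obtain ⟨c, hc, hcz, h1, h2⟩ := after z e
      rw [scoresOfConsecutive_of_lt _ _ (h.lt.trans e), scoresOfConsecutive_of_lt _ _ e,
        cutSet_left _ h e.le]
      refine sSup_insert_of_le (finite_cutSet _ _ _ _) ⟨x', c, hc, le_rfl, hcz, rfl⟩ ?_
      simp only [h0]; linarith
    · obtain ⟨c, hc, hcz, h1, h2⟩ := before z e
      rw [scoresOfConsecutive_of_gt _ _ e, scoresOfConsecutive_of_gt _ _ (e.trans h.lt),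
        cutSet_right _ h e.le]
      refine (sInf_insert_of_ge (finite_cutSet _ _ _ _) ⟨c, x, hc, hcz, le_rfl, rfl⟩ ?_).symm
      simp only [h0]; linarith
  · intro z hz hz'
    rcases cases z hz hz' with e | e
    · obtain ⟨c, hc, hcz, h1, h2⟩ := after z e
      rw [scoresOfConsecutive_of_gt _ _ (h.lt.trans e), scoresOfConsecutive_of_gt _ _ e,
        cutSet_left _ h e.le]
      refine sInf_insert_of_ge (finite_cutSet _ _ _ _) ⟨x', c, hc, le_rfl, hcz, rfl⟩ ?_
      simp only [h0]; linarith
    · obtain ⟨c, hc, hcz, h1, h2⟩ := before z e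
      rw [scoresOfConsecutive_of_lt _ _ e, scoresOfConsecutive_of_lt _ _ (e.trans h.lt),
        cutSet_right _ h e.le]
      refine (sSup_insert_of_le (finite_cutSet _ _ _ _) ⟨c, x, hc, hcz, le_rfl, rfl⟩ ?_).symm
      simp only [h0]; linarith
  · have hempty : ∀ f, cutSet ξ f x x = ∅ := by
      intro f
      ext s
      simp only [mem_empty_iff_false, iff_false]
      rintro ⟨p, q, hpq, hp, hq, -⟩
      exact absurd (hpq.lt.trans_le (hq.trans hp)) (lt_irrefl _)
    rw [scoresOfConsecutive_of_lt _ _ h.lt, scoresOfConsecutive_of_gt _ _ h.lt,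
      cutSet_right _ h le_rfl, cutSet_right _ h le_rfl, hempty, hempty]
    simp [h0]

theorem IsAdmissible.projection_swap {v : A → A → ℝ} (hξ : IsAdmissible v ξ)
    (h : ξ.Next x x') (h0 : indirectMargin v x x' = 0) {τ : A → A → ℝ}
    (hτ : IsIntermediateTurnout v ξ τ) :
    IsIntermediateTurnout v ((Equiv.swap x x').trans ξ : Ranking A) τ ∧
      scoresOfConsecutive ((Equiv.swap x x').trans ξ : Ranking A)
        (intermediateMargin v ((Equiv.swap x x').trans ξ : Ranking A)) τ =
      scoresOfConsecutive ξ (intermediateMargin v ξ) τ := by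
  have hm := hξ.intermediateMargin_swap h h0
  have hm0 := hξ.intermediateMargin_eq_zero h.lt h0
  have hcompat : ∀ τ, IsCompatibleTurnout ((Equiv.swap x x').trans ξ : Ranking A)
      (intermediateMargin v ((Equiv.swap x x').trans ξ : Ranking A)) τ ↔
      IsCompatibleTurnout ξ (intermediateMargin v ξ) τ := by
    intro τ
    constructor
    · intro hτ
      -- The relabelled matrix is compatible for `ξ`, hence invariant under the exchange, hence
      -- equal to `τ`.
      have h1 : IsCompatibleTurnout ξ (intermediateMargin v ξ)
          (fun a b => τ (Equiv.swap x x' a) (Equiv.swap x x' b)) := by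
        rw [← isCompatibleTurnout_relabel hm]
        simpa using hτ
      have h2 := h1.swap_eq h hm0
      simp only [Equiv.swap_apply_self] at h2
      rwa [← h2] at h1
    · intro hτ
      have h1 := (isCompatibleTurnout_relabel hm).2 hτ
      rwa [hτ.swap_eq h hm0] at h1
  refine ⟨⟨(hcompat τ).2 hτ.1, fun τ' h' => hτ.2 τ' ((hcompat τ').1 h')⟩, ?_⟩
  ext a b
  rw [← hτ.1.scores_swap (fun p q hpq => hξ.intermediateMargin_nonneg hpq.lt) h hm0,
    ← scoresOfConsecutive_relabel hm, hτ.1.swap_eq h hm0]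

end Swap

/-! ### Independence of the admissible order -/

theorem Ranking.eq_of_forall_next {ξ ξ' : Ranking A} (h : ∀ x y, ξ.Next x y → ξ' x < ξ' y) :
    ξ = ξ' := by
  have h1 : ∀ (d : ℕ) (x y : A), (ξ y : ℕ) = ξ x + d + 1 → ξ' x < ξ' y := by
    intro d
    induction d with
    | zero => exact fun x y e => h x y e
    | succ d ih =>
      intro x y e
      obtain ⟨z, hz⟩ := Ranking.exists_next (ξ := ξ) (x := x) (y := y) (by rw [Fin.lt_def]; omega)
      refine (h x z hz).trans (ih z y ?_)
      unfold Ranking.Next at hz; omega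
  have h2 : StrictMono (ξ' ∘ ξ.symm) := by
    intro i j hij
    refine h1 (j - i - 1) _ _ ?_
    simp only [Equiv.apply_symm_apply]
    rw [Fin.lt_def] at hij; omega
  have h3 : ξ' ∘ ξ.symm = id := StrictMono.range_inj h2 strictMono_id |>.1 (by
    rw [range_id, (ξ'.surjective.comp ξ.symm.surjective).range_eq])
  ext x
  have := congrFun h3 (ξ x)
  simp only [Function.comp_apply, Equiv.symm_apply_apply, id] at this
  rw [this]

/-- Bubble sort, by induction on the number of pairs ordered oppositely. If the orders differ, some
neighbours of `ξ` are reversed in `ξ'`; admissibility of both orders forces their indirect margin to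
be zero, and exchanging them removes one reversal. -/
theorem IsAdmissible.projection_eq {v : A → A → ℝ} {ξ ξ' : Ranking A} (hξ : IsAdmissible v ξ)
    (hξ' : IsAdmissible v ξ') {τ : A → A → ℝ} (hτ : IsIntermediateTurnout v ξ τ) :
    IsIntermediateTurnout v ξ' τ ∧ scoresOfConsecutive ξ' (intermediateMargin v ξ') τ =
      scoresOfConsecutive ξ (intermediateMargin v ξ) τ := by
  classical
  induction hn : (Finset.univ.filter fun p : A × A => ξ p.1 < ξ p.2 ∧ ξ' p.2 < ξ' p.1).card
    using Nat.strong_induction_on generalizing ξ with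
  | _ n ih =>
    by_cases hex : ∃ x x', ξ.Next x x' ∧ ξ' x' < ξ' x
    · obtain ⟨x, x', h, hlt⟩ := hex
      have h0 : indirectMargin v x x' = 0 := by
        refine le_antisymm ?_ (hξ.indirectMargin_nonneg h.lt)
        have := hξ'.indirectMargin_nonneg hlt
        unfold indirectMargin at this ⊢
        linarith
      obtain ⟨h1, h2⟩ := hξ.projection_swap h h0 hτ
      rw [← h2]
      refine ih _ ?_ (hξ.swap h h0) h1 rfl
      rw [← hn]
      refine Finset.card_lt_card (Finset.ssubset_iff_of_subset ?_ |>.2 ⟨(x, x'), ?_, ?_⟩)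
      · rintro ⟨p, q⟩ hpq
        rw [Finset.mem_filter] at hpq ⊢
        replace hpq := hpq.2
        refine ⟨Finset.mem_univ _, ?_, hpq.2⟩
        have := h.swap_lt_swap hpq.1
        dsimp only at this
        rw [Equiv.swap_apply_self, Equiv.swap_apply_self] at this
        refine this ?_
        rintro ⟨e1, e2⟩
        rw [Equiv.swap_apply_eq_iff, Equiv.swap_apply_left] at e1
        rw [Equiv.swap_apply_eq_iff, Equiv.swap_apply_right] at e2
        rw [e1, e2] at hpq
        exact lt_asymm hlt hpq.2
      · simp [h.lt, hlt]
      · rw [Finset.mem_filter]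
        simp [h.lt.le]
    · push Not at hex
      obtain rfl : ξ = ξ' := Ranking.eq_of_forall_next fun x y hxy =>
        lt_of_le_of_ne (hex x y hxy) fun e => hxy.ne (ξ'.injective e)
      exact ⟨hτ, rfl⟩

/-! ### Existence, uniqueness and continuity of the projected matrix. -/

theorem IsCLCProjection.unique {v w w' : A → A → ℝ} (h : IsCLCProjection v w)
    (h' : IsCLCProjection v w') : w = w' := by
  obtain ⟨ξ, hξ, τ, hτ, rfl⟩ := h
  obtain ⟨ξ', hξ', τ', hτ', rfl⟩ := h'
  obtain ⟨h1, h2⟩ := hξ.projection_eq hξ' hτ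
  rw [← h2, h1.unique hτ']

theorem IsLlull.exists_isCLCProjection {v : A → A → ℝ} (hv : IsLlull v) :
    ∃ w, IsCLCProjection v w := by
  obtain ⟨ξ, hξ⟩ := exists_isAdmissible v
  obtain ⟨τ, hτ⟩ := exists_isIntermediateTurnout hv hξ
  exact ⟨_, ξ, hξ, τ, hτ, rfl⟩

theorem IsCLCProjection.continuous {X : Type*} [TopologicalSpace X] {v w : X → A → A → ℝ}
    (hv : Continuous v) (hL : ∀ i, IsLlull (v i)) (h : ∀ i, IsCLCProjection (v i) (w i)) :
    Continuous w := by
  rw [continuous_iff_ultrafilter]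
  intro i g hg
  choose ξ hξ τ hτ hw using h
  have hv' : Tendsto v g (𝓝 (v i)) := (hv.tendsto i).mono_left hg
  -- The chosen orders may jump with the parameter, but an ultrafilter on finitely many orders is
  -- principal.
  obtain ⟨ξ₀, hξ₀⟩ := (g.map ξ).eq_pure_of_finite
  have hev : ∀ᶠ j in g, ξ j = ξ₀ := by
    have : {ξ₀} ∈ g.map ξ := by rw [hξ₀]; exact rfl
    exact this
  have hadm : ∀ᶠ j in g, IsAdmissible (v j) ξ₀ := hev.mono fun j hj => hj ▸ hξ j
  have hτ₀ : ∀ᶠ j in g, IsIntermediateTurnout (v j) ξ₀ (τ j) := hev.mono fun j hj => hj ▸ hτ j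
  have hadm₀ : IsAdmissible (v i) ξ₀ := (isClosed_isAdmissible ξ₀).mem_of_tendsto hv' hadm
  obtain ⟨τ₀, -, hlim⟩ := (isCompact_bounded (Fintype.card (A × A) + 2 : ℝ)).ultrafilter_le_nhds
    (g.map τ) (le_principal_iff.2 (mem_map.2 (Eventually.of_forall fun j =>
      (hL j).abs_le_of_turnoutDist_le (hτ j).1.diag ((hτ j).2 _ (isCompatible_one (hL j) (hξ j))))))
  have hlim' : Tendsto τ g (𝓝 τ₀) := hlim
  have hτi := IsIntermediateTurnout.of_tendsto hv' hlim' hL hadm₀ hadm hτ₀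
  -- The order chosen at the limit point may differ from `ξ₀`; independence of the order makes this
  -- harmless.
  have hwi : w i = scoresOfConsecutive ξ₀ (intermediateMargin (v i) ξ₀) τ₀ :=
    IsCLCProjection.unique ⟨ξ i, hξ i, τ i, hτ i, hw i⟩ ⟨ξ₀, hadm₀, τ₀, hτi, rfl⟩
  rw [hwi, tendsto_pi_nhds]
  intro x
  rw [tendsto_pi_nhds]
  intro y
  refine (tendsto_scoresOfConsecutive ξ₀ (m := fun j => intermediateMargin (v j) ξ₀)
    (fun x y => ((continuous_intermediateMargin ξ₀ x y).tendsto (v i)).comp hv')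
    (fun x y => (tendsto_pi_nhds.1 (tendsto_pi_nhds.1 hlim' x)) y) x y).congr' ?_
  filter_upwards [hev] with j hj
  rw [hw j, hj]

end CLC

namespace CLC
variable {A : Type*}

theorem div_add_pos {φ : A → ℝ} (hφ : ∀ x, 0 < φ x) (x y : A) : 0 < φ x / (φ x + φ y) :=
  div_pos (hφ x) (add_pos (hφ x) (hφ y))

theorem div_add_le_one {φ : A → ℝ} (hφ : ∀ x, 0 < φ x) (x y : A) : φ x / (φ x + φ y) ≤ 1 :=
  (div_le_one (add_pos (hφ x) (hφ y))).2 (le_add_of_nonneg_right (hφ y).le)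

open scoped Classical in
theorem prod_le_of_le_one {ι : Type*} {s : Finset ι} {f : ι → ℝ} (h0 : ∀ i ∈ s, 0 ≤ f i)
    (h1 : ∀ i ∈ s, f i ≤ 1) {i : ι} (hi : i ∈ s) : ∏ j ∈ s, f j ≤ f i := by
  rw [← Finset.mul_prod_erase s f hi]
  exact mul_le_of_le_one_right (h0 i hi) (Finset.prod_le_one
    (fun j hj => h0 j (Finset.mem_of_mem_erase hj)) fun j hj => h1 j (Finset.mem_of_mem_erase hj))

variable [Fintype A]

/-! ### Positivity of the projected scores -/

/-- Turnouts of consecutive pairs decrease weakly along the order: for consecutive `z y y'`, `τ y y'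
≤ τ z y' ≤ τ z y`. -/
theorem IsCompatibleTurnout.le_first {ξ : Ranking A} {m τ : A → A → ℝ}
    (hτ : IsCompatibleTurnout ξ m τ) {x x' : A} (hx : (ξ x : ℕ) = 0) (h : ξ.Next x x') {y y' : A}
    (hy : ξ.Next y y') : τ y y' ≤ τ x x' := by
  induction hk : (ξ y : ℕ) generalizing y y' with
  | zero =>
    obtain rfl : y = x := ξ.injective (Fin.ext (hk.trans hx.symm))
    rw [hy.eq_right h]
  | succ k ih =>
    obtain ⟨z, hz⟩ := Ranking.exists_prev (ξ := ξ) (x := x) (y := y) (by rw [Fin.lt_def]; omega)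
    refine le_trans ?_ (ih hz (by unfold Ranking.Next at hz; omega))
    have hzy : z ≠ y' := (hz.lt.trans hy.lt).ne ∘ congrArg ξ
    have h1 := (hτ.diff z y y' hz hzy.symm hy.ne.symm).1
    have h2 := (hτ.diff y y' z hy hz.ne hzy).1
    rw [hτ.symm y z, hτ.symm y' z] at h2
    linarith

/-- Otherwise all consecutive turnouts and margins vanish, and then so does all of `τ`. With zero
margins every constant in `[0, 1]` is compatible, and the mean of the nonzero turnouts is strictly
nearer than `0`. -/
theorem IsIntermediateTurnout.first_pos {v τ : A → A → ℝ} {ξ : Ranking A} (hv : IsLlull v)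
    (hne : ∃ x y, x ≠ y ∧ v x y ≠ 0) (hξ : IsAdmissible v ξ) (hτ : IsIntermediateTurnout v ξ τ)
    {x x' : A} (hx : (ξ x : ℕ) = 0) (h : ξ.Next x x') : 0 < τ x x' := by
  classical
  have hm : ∀ y y', ξ.Next y y' → 0 ≤ intermediateMargin v ξ y y' :=
    fun y y' hy => hξ.intermediateMargin_nonneg hy.lt
  by_contra hc
  have hcons : ∀ y y', ξ.Next y y' → τ y y' = 0 ∧ intermediateMargin v ξ y y' = 0 := by
    intro y y' hy
    have h1 := hτ.1.le_first hx h hy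
    have h2 := (hτ.1.bounds y y' hy).1
    have h3 := hm y y' hy
    constructor <;> linarith
  have hlt : ∀ (d : ℕ) (y z : A), (ξ z : ℕ) = ξ y + d + 1 → τ y z = 0 := by
    intro d
    induction d with
    | zero => exact fun y z e => (hcons y z e).1
    | succ d ih =>
      intro y z e
      obtain ⟨y', hy⟩ := Ranking.exists_next (ξ := ξ) (x := y) (y := z) (by rw [Fin.lt_def]; omega)
      have hy2 : (ξ y' : ℕ) = ξ y + 1 := hy
      have hzy : z ≠ y := by rintro rfl; omega
      have hzy' : z ≠ y' := by rintro rfl; omega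
      have h1 := hτ.1.diff y y' z hy hzy hzy'
      rw [(hcons y y' hy).2, ih y' z (by omega)] at h1
      linarith [h1.1, h1.2]
  have hzero : ∀ y z, τ y z = 0 := by
    intro y z
    rcases lt_trichotomy (ξ y) (ξ z) with e | e | e
    · rw [Fin.lt_def] at e
      exact hlt (ξ z - ξ y - 1) y z (by omega)
    · rw [ξ.injective e, hτ.1.diag]
    · rw [Fin.lt_def] at e
      rw [hτ.1.symm]
      exact hlt (ξ y - ξ z - 1) z y (by omega)
  set D : Finset (A × A) := Finset.univ.filter fun p => p.2 ≠ p.1 with hD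
  have hmem : ∀ p ∈ D, turnout v p.1 p.2 ∈ Icc (0 : ℝ) 1 := fun p hp =>
    hv.turnout_mem (Finset.mem_filter.1 hp).2.symm
  set s : ℝ := ∑ p ∈ D, turnout v p.1 p.2 with hs
  have hspos : 0 < s := by
    obtain ⟨y, z, hyz, hvyz⟩ := hne
    refine Finset.sum_pos' (fun p hp => (hmem p hp).1) ⟨(y, z), by simp [hD, hyz.symm], ?_⟩
    have h1 := (hv.mem_Icc y z hyz).1
    have h2 := (hv.mem_Icc z y hyz.symm).1
    exact add_pos_of_pos_of_nonneg (lt_of_le_of_ne h1 hvyz.symm) h2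
  have hsD : s ≤ D.card := by
    have := Finset.sum_le_card_nsmul D (fun p => turnout v p.1 p.2) 1 fun p hp => (hmem p hp).2
    simpa using this
  have hDpos : (0 : ℝ) < D.card := hspos.trans_le hsD
  -- The best constant: it lowers the squared distance by `c * s`.
  set c : ℝ := s / D.card with hcdef
  have hc0 : 0 < c := div_pos hspos hDpos
  have hc1 : c ≤ 1 := (div_le_one hDpos).2 hsD
  have hle : turnoutDist v τ ≤ turnoutDist v (constTurnout c) :=
    hτ.2 _ (isCompatibleTurnout_constTurnout hc1 hm fun y y' hy => by
      rw [(hcons y y' hy).2]; exact hc0.le)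
  have heq : turnoutDist v (constTurnout c) = turnoutDist v τ + (c ^ 2 * D.card - 2 * c * s) := by
    rw [turnoutDist_eq, turnoutDist_eq, hs, Finset.mul_sum, mul_comm, ← nsmul_eq_mul,
      ← Finset.sum_const, ← Finset.sum_sub_distrib, ← Finset.sum_add_distrib]
    refine Finset.sum_congr (by ext; simp) fun p hp => ?_
    rw [hzero, constTurnout_of_ne _ (Finset.mem_filter.1 hp).2.symm]
    ring
  have hcs : c * D.card = s := div_mul_cancel₀ s hDpos.ne'
  have : c ^ 2 * D.card = c * s := by rw [← hcs]; ring
  have := mul_pos hc0 hspos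
  linarith

theorem IsCLCProjection.nonneg {v w : A → A → ℝ} (h : IsCLCProjection v w) (x y : A) :
    0 ≤ w x y := by
  obtain ⟨ξ, hξ, τ, hτ, rfl⟩ := h
  have hb : ∀ p q, ξ.Next p q → 0 ≤ intermediateMargin v ξ p q ∧
      intermediateMargin v ξ p q ≤ τ p q :=
    fun p q hpq => ⟨hξ.intermediateMargin_nonneg hpq.lt, (hτ.1.bounds p q hpq).1⟩
  rcases lt_trichotomy (ξ x) (ξ y) with e | e | e
  · rw [scoresOfConsecutive_of_lt _ _ e]
    refine Real.sSup_nonneg ?_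
    rintro _ ⟨p, q, hpq, -, -, rfl⟩
    linarith [hb p q hpq]
  · rw [ξ.injective e]; simp [scoresOfConsecutive]
  · rw [scoresOfConsecutive_of_gt _ _ e]
    refine Real.sInf_nonneg ?_
    rintro _ ⟨p, q, hpq, -, -, rfl⟩
    linarith [hb p q hpq]

/-- The first option works: its score over any `y` is a maximum that includes the first consecutive
pair. Apart from nonnegativity, this is all that the existence of strengths needs. -/
theorem IsCLCProjection.exists_forall_pos {v w : A → A → ℝ} (hv : v ∈ nonvanishingLlull A)
    (h : IsCLCProjection v w) : ∃ x, ∀ y, y ≠ x → 0 < w x y := by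
  obtain ⟨ξ, hξ, τ, hτ, rfl⟩ := h
  obtain ⟨a, -⟩ := hv.2
  have hcard : 0 < Fintype.card A := Fintype.card_pos_iff.2 ⟨a⟩
  refine ⟨ξ.symm ⟨0, hcard⟩, fun y hy => ?_⟩
  set x := ξ.symm ⟨0, hcard⟩
  have hx : (ξ x : ℕ) = 0 := by simp [x]
  have hlt : ξ x < ξ y := by
    have : ξ y ≠ ξ x := fun e => hy (ξ.injective e)
    rw [Ne, Fin.ext_iff] at this
    rw [Fin.lt_def]; omega
  obtain ⟨x', hx'⟩ := Ranking.exists_next hlt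
  have hpos := hτ.first_pos hv.1 hv.2 hξ hx hx'
  have hm := hξ.intermediateMargin_nonneg hx'.lt
  rw [scoresOfConsecutive_of_lt _ _ hlt]
  exact lt_of_lt_of_le (by linarith : 0 < (τ x x' + intermediateMargin v ξ x x') / 2)
    (le_csSup (finite_cutSet _ _ _ _).bddAbove ⟨x, x', hx', le_rfl, (hx'.le_iff y).2 hlt, rfl⟩)

/-! ### The likelihood -/

open scoped Classical in
theorem likelihood_eq (w : A → A → ℝ) (φ : A → ℝ) :
    likelihood w φ = ∏ p : A × A with p.2 ≠ p.1, (φ p.1 / (φ p.1 + φ p.2)) ^ w p.1 p.2 := by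
  simp only [likelihood, Finset.prod_filter, Fintype.prod_prod_type]

theorem likelihood_pos (w : A → A → ℝ) {φ : A → ℝ} (hφ : ∀ x, 0 < φ x) : 0 < likelihood w φ :=
  Finset.prod_pos fun x _ => Finset.prod_pos fun y _ => Real.rpow_pos_of_pos (div_add_pos hφ x y) _

theorem likelihood_le_one {w : A → A → ℝ} (hw : ∀ x y, 0 ≤ w x y) {φ : A → ℝ}
    (hφ : ∀ x, 0 < φ x) : likelihood w φ ≤ 1 := by
  classical
  rw [likelihood_eq]
  exact Finset.prod_le_one (fun p _ => Real.rpow_nonneg (div_add_pos hφ _ _).le _)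
    fun p _ => Real.rpow_le_one (div_add_pos hφ _ _).le (div_add_le_one hφ _ _) (hw _ _)

theorem likelihood_le_rpow {w : A → A → ℝ} (hw : ∀ x y, 0 ≤ w x y) {φ : A → ℝ}
    (hφ : ∀ x, 0 < φ x) {x y : A} (hxy : x ≠ y) :
    likelihood w φ ≤ (φ x / (φ x + φ y)) ^ w x y := by
  classical
  rw [likelihood_eq]
  exact prod_le_of_le_one (f := fun p : A × A => (φ p.1 / (φ p.1 + φ p.2)) ^ w p.1 p.2)
    (i := (x, y)) (fun p _ => Real.rpow_nonneg (div_add_pos hφ _ _).le _)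
    (fun p _ => Real.rpow_le_one (div_add_pos hφ _ _).le (div_add_le_one hφ _ _) (hw _ _))
    (by simp [hxy.symm])

/-- All bases lie in `(0, 1]`, so larger exponents give smaller factors. -/
theorem likelihood_le_likelihood_rpow {w w' : A → A → ℝ} {c : ℝ} (h : ∀ x y, c * w x y ≤ w' x y)
    {φ : A → ℝ} (hφ : ∀ x, 0 < φ x) : likelihood w' φ ≤ likelihood w φ ^ c := by
  classical
  rw [likelihood_eq, likelihood_eq,
    ← Real.finsetProd_rpow _ _ fun p _ => Real.rpow_nonneg (div_add_pos hφ _ _).le _]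
  refine Finset.prod_le_prod (fun p _ => Real.rpow_nonneg (div_add_pos hφ _ _).le _) fun p _ => ?_
  rw [← Real.rpow_mul (div_add_pos hφ _ _).le, mul_comm]
  exact Real.rpow_le_rpow_of_exponent_ge (div_add_pos hφ _ _) (div_add_le_one hφ _ _) (h _ _)

theorem continuous_likelihood_left {φ : A → ℝ} (hφ : ∀ x, 0 < φ x) :
    Continuous fun w : A → A → ℝ => likelihood w φ := by
  unfold likelihood
  refine continuous_finsetProd _ fun x _ => continuous_finsetProd _ fun y _ => ?_
  exact (Real.continuous_const_rpow (div_add_pos hφ x y).ne').comp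
    (continuous_apply_apply (ρ := fun _ _ => ℝ) x y)

theorem likelihood_smul (w : A → A → ℝ) {c : ℝ} (hc : c ≠ 0) (φ : A → ℝ) :
    likelihood w (fun x => c * φ x) = likelihood w φ := by
  simp only [likelihood, ← mul_add, mul_div_mul_left _ _ hc]

/-- The supremum of the likelihood. -/
noncomputable def likelihoodSup (w : A → A → ℝ) : ℝ := sSup (likelihood w '' strengthSet A)

theorem bddAbove_likelihood {w : A → A → ℝ} (hw : ∀ x y, 0 ≤ w x y) :
    BddAbove (likelihood w '' strengthSet A) := by
  refine ⟨1, ?_⟩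
  rintro _ ⟨φ, hφ, rfl⟩
  exact likelihood_le_one hw hφ.1

theorem likelihood_le_sup {w : A → A → ℝ} (hw : ∀ x y, 0 ≤ w x y) {φ : A → ℝ}
    (hφ : φ ∈ strengthSet A) : likelihood w φ ≤ likelihoodSup w :=
  le_csSup (bddAbove_likelihood hw) ⟨φ, hφ, rfl⟩

theorem likelihood_le_sup_of_pos [Nonempty A] {w : A → A → ℝ} (hw : ∀ x y, 0 ≤ w x y) {φ : A → ℝ}
    (hφ : ∀ x, 0 < φ x) : likelihood w φ ≤ likelihoodSup w := by
  have hs : 0 < ∑ x, φ x := Finset.sum_pos (fun x _ => hφ x) Finset.univ_nonempty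
  rw [← likelihood_smul w (inv_ne_zero hs.ne') φ]
  refine likelihood_le_sup hw ⟨fun x => mul_pos (inv_pos.2 hs) (hφ x), ?_⟩
  rw [← Finset.mul_sum, inv_mul_cancel₀ hs.ne']

theorem strengthSet_nonempty [Nonempty A] : (strengthSet A).Nonempty := by
  have : (0 : ℝ) < Fintype.card A := Nat.cast_pos.2 Fintype.card_pos
  exact ⟨fun _ => (Fintype.card A : ℝ)⁻¹, fun _ => inv_pos.2 this, by simp [this.ne']⟩

theorem likelihoodSup_pos [Nonempty A] {w : A → A → ℝ} (hw : ∀ x y, 0 ≤ w x y) :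
    0 < likelihoodSup w := by
  obtain ⟨φ, hφ⟩ := strengthSet_nonempty (A := A)
  exact (likelihood_pos w hφ.1).trans_le (likelihood_le_sup hw hφ)

theorem exists_maximizing [Nonempty A] {w : A → A → ℝ} (hw : ∀ x y, 0 ≤ w x y) :
    ∃ ψ : ℕ → A → ℝ, (∀ n, ψ n ∈ strengthSet A) ∧
      Tendsto (fun n => likelihood w (ψ n)) atTop (𝓝 (likelihoodSup w)) := by
  obtain ⟨u, -, hu, hmem⟩ := exists_seq_tendsto_sSup (strengthSet_nonempty.image (likelihood w))
    (bddAbove_likelihood hw)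
  choose ψ hψ hψu using hmem
  obtain rfl : (fun n => likelihood w (ψ n)) = u := funext hψu
  exact ⟨ψ, hψ, hu⟩

/-- Quantitative log-concavity in logarithmic coordinates: the product equals the squared likelihood
at the geometric mean `ω` times powers of ratios that are at most `1` by Cauchy–Schwarz, and only
one ratio is kept. Since `ω` need not sum to `1`, scale invariance is used. -/
theorem likelihood_mul_le [Nonempty A] {w : A → A → ℝ} (hw : ∀ x y, 0 ≤ w x y) {φ χ : A → ℝ}
    (hφ : ∀ x, 0 < φ x) (hχ : ∀ x, 0 < χ x) {x y : A} (hxy : x ≠ y) :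
    likelihood w φ * likelihood w χ ≤ likelihoodSup w ^ 2 *
      ((√(φ x * χ x) + √(φ y * χ y)) ^ 2 / ((φ x + φ y) * (χ x + χ y))) ^ w x y := by
  classical
  set ω : A → ℝ := fun x => √(φ x * χ x)
  have hω : ∀ x, 0 < ω x := fun x => Real.sqrt_pos.2 (mul_pos (hφ x) (hχ x))
  have hω2 : ∀ x, ω x ^ 2 = φ x * χ x := fun x => Real.sq_sqrt (mul_pos (hφ x) (hχ x)).le
  set r : A × A → ℝ := fun p =>
    (ω p.1 + ω p.2) ^ 2 / ((φ p.1 + φ p.2) * (χ p.1 + χ p.2))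
  have hden : ∀ p : A × A, 0 < (φ p.1 + φ p.2) * (χ p.1 + χ p.2) := fun p =>
    mul_pos (add_pos (hφ _) (hφ _)) (add_pos (hχ _) (hχ _))
  have hr0 : ∀ p, 0 ≤ r p := fun p => div_nonneg (sq_nonneg _) (hden p).le
  have hr1 : ∀ p, r p ≤ 1 := by
    intro p
    refine (div_le_one (hden p)).2 ?_
    have h1 := hω2 p.1
    have h2 := hω2 p.2
    have h3 : ω p.1 * ω p.2 * 2 ≤ φ p.1 * χ p.2 + φ p.2 * χ p.1 := by
      refine le_of_sq_le_sq ?_ (add_nonneg (mul_pos (hφ _) (hχ _)).le (mul_pos (hφ _) (hχ _)).le)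
      have : (ω p.1 * ω p.2 * 2) ^ 2 = 4 * (φ p.1 * χ p.1) * (φ p.2 * χ p.2) := by
        rw [← h1, ← h2]; ring
      rw [this]
      nlinarith [sq_nonneg (φ p.1 * χ p.2 - φ p.2 * χ p.1)]
    nlinarith
  have hprod : likelihood w φ * likelihood w χ = likelihood w ω ^ 2 *
      ∏ p : A × A with p.2 ≠ p.1, r p ^ w p.1 p.2 := by
    rw [likelihood_eq, likelihood_eq, likelihood_eq, ← Finset.prod_pow, ← Finset.prod_mul_distrib,
      ← Finset.prod_mul_distrib]
    refine Finset.prod_congr rfl fun p _ => ?_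
    rw [sq, ← Real.mul_rpow (div_add_pos hφ _ _).le (div_add_pos hχ _ _).le,
      ← Real.mul_rpow (div_add_pos hω _ _).le (div_add_pos hω _ _).le,
      ← Real.mul_rpow (mul_pos (div_add_pos hω _ _) (div_add_pos hω _ _)).le (hr0 p)]
    congr 1
    have h1 := hω2 p.1
    have h2 := (add_pos (hω p.1) (hω p.2)).ne'
    have h3 := (add_pos (hφ p.1) (hφ p.2)).ne'
    have h4 := (add_pos (hχ p.1) (hχ p.2)).ne'
    simp only [r]
    field_simp
    exact h1.symm
  rw [hprod]
  refine mul_le_mul ?_ ?_ (Finset.prod_nonneg fun p _ => Real.rpow_nonneg (hr0 p) _) (sq_nonneg _)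
  · exact pow_le_pow_left₀ (likelihood_pos w hω).le (likelihood_le_sup_of_pos hw hω) 2
  · exact prod_le_of_le_one (f := fun p : A × A => r p ^ w p.1 p.2) (i := (x, y))
      (fun p _ => Real.rpow_nonneg (hr0 p) _)
      (fun p _ => Real.rpow_le_one (hr0 p) (hr1 p) (hw _ _)) (by simp [hxy.symm])

/-! ### Existence and uniqueness of the strengths -/

/-- The product of likelihoods tends to the squared supremum, so the Cauchy–Schwarz ratio of a pair
with positive exponent tends to `1`; the equality case gives proportionality. -/
theorem mul_eq_mul_of_maximizing [Nonempty A] {w : A → A → ℝ} (hw : ∀ x y, 0 ≤ w x y)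
    {ψ χ : ℕ → A → ℝ} (hψ : ∀ n, ψ n ∈ strengthSet A) (hχ : ∀ n, χ n ∈ strengthSet A)
    (hψS : Tendsto (fun n => likelihood w (ψ n)) atTop (𝓝 (likelihoodSup w)))
    (hχS : Tendsto (fun n => likelihood w (χ n)) atTop (𝓝 (likelihoodSup w)))
    {a b : A → ℝ} (ha : Tendsto ψ atTop (𝓝 a)) (hb : Tendsto χ atTop (𝓝 b)) {x y : A}
    (hxy : x ≠ y) (hwxy : 0 < w x y) : a x * b y = a y * b x := by
  have hS := likelihoodSup_pos hw
  rw [tendsto_pi_nhds] at ha hb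
  have ha0 : ∀ z, 0 ≤ a z := fun z =>
    ge_of_tendsto (ha z) (Eventually.of_forall fun n => ((hψ n).1 z).le)
  have hb0 : ∀ z, 0 ≤ b z := fun z =>
    ge_of_tendsto (hb z) (Eventually.of_forall fun n => ((hχ n).1 z).le)
  -- The denominators may vanish in the limit, so the bound is cleared of fractions before passing
  -- to it.
  have key : ∀ c : ℝ, 0 < c → c < 1 →
      c * ((a x + a y) * (b x + b y)) ≤ (√(a x * b x) + √(a y * b y)) ^ 2 := by
    intro c hc0 hc1
    have hlim := hψS.mul hχS
    have hcw : c ^ w x y < 1 := Real.rpow_lt_one hc0.le hc1 hwxy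
    have hlt : likelihoodSup w ^ 2 * c ^ w x y < likelihoodSup w * likelihoodSup w := by
      nlinarith [mul_pos hS hS]
    refine le_of_tendsto_of_tendsto
      ((((ha x).add (ha y)).mul ((hb x).add (hb y))).const_mul c)
      (((((ha x).mul (hb x)).sqrt).add (((ha y).mul (hb y)).sqrt)).pow 2) ?_
    filter_upwards [hlim.eventually (lt_mem_nhds hlt)] with n hn
    have h1 := hn.trans_le (likelihood_mul_le hw (hψ n).1 (hχ n).1 hxy)
    have h2 := lt_of_mul_lt_mul_left h1 (sq_nonneg _)
    have hden : 0 < (ψ n x + ψ n y) * (χ n x + χ n y) :=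
      mul_pos (add_pos ((hψ n).1 _) ((hψ n).1 _)) (add_pos ((hχ n).1 _) ((hχ n).1 _))
    have h3 := (Real.rpow_lt_rpow_iff hc0.le (div_nonneg (sq_nonneg _) hden.le) hwxy).1 h2
    exact ((lt_div_iff₀ hden).1 h3).le
  have hfin : (a x + a y) * (b x + b y) ≤ (√(a x * b x) + √(a y * b y)) ^ 2 := by
    have hlim : Tendsto (fun c : ℝ => c * ((a x + a y) * (b x + b y))) (𝓝[<] 1)
        (𝓝 (1 * ((a x + a y) * (b x + b y)))) :=
      (tendsto_id.mono_left nhdsWithin_le_nhds).mul_const _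
    rw [one_mul] at hlim
    refine le_of_tendsto hlim ?_
    filter_upwards [Ioo_mem_nhdsLT (zero_lt_one (α := ℝ))] with c hc using key c hc.1 hc.2
  have hs := Real.sq_sqrt (mul_nonneg (ha0 x) (hb0 x))
  have ht := Real.sq_sqrt (mul_nonneg (ha0 y) (hb0 y))
  set s := √(a x * b x)
  set t := √(a y * b y)
  have h1 : a x * b y + a y * b x ≤ 2 * (s * t) := by nlinarith
  have h2 : (a x * b y + a y * b x) ^ 2 ≤ (2 * (s * t)) ^ 2 := pow_le_pow_left₀
    (add_nonneg (mul_nonneg (ha0 _) (hb0 _)) (mul_nonneg (ha0 _) (hb0 _))) h1 2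
  have h3 : (2 * (s * t)) ^ 2 = 4 * ((a x * b x) * (a y * b y)) := by rw [← hs, ← ht]; ring
  have h4 : (a x * b y - a y * b x) ^ 2 = 0 :=
    le_antisymm (by rw [h3] at h2; nlinarith) (sq_nonneg _)
  exact sub_eq_zero.1 (pow_eq_zero_iff two_ne_zero |>.1 h4)

theorem strengthSet_subset_stdSimplex : strengthSet A ⊆ stdSimplex ℝ A :=
  fun _ h => ⟨fun x => (h.1 x).le, h.2⟩

theorem pos_of_maximizing [Nonempty A] {w : A → A → ℝ} (hw : ∀ x y, 0 ≤ w x y)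
    {ψ : ℕ → A → ℝ} (hψ : ∀ n, ψ n ∈ strengthSet A)
    (hψS : Tendsto (fun n => likelihood w (ψ n)) atTop (𝓝 (likelihoodSup w)))
    {a : A → ℝ} (ha : Tendsto ψ atTop (𝓝 a)) {x : A} (hx : ∀ y, y ≠ x → 0 < w x y) :
    0 < a x := by
  have hS := likelihoodSup_pos hw
  have hmem : a ∈ stdSimplex ℝ A := (isClosed_stdSimplex ℝ A).mem_of_tendsto ha
    (Eventually.of_forall fun n => strengthSet_subset_stdSimplex (hψ n))
  rw [tendsto_pi_nhds] at ha
  refine lt_of_le_of_ne (hmem.1 x) fun hzero => ?_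
  have hall : ∀ y, a y ≤ 0 := by
    intro y
    by_cases hyx : y = x
    · rw [hyx, ← hzero]
    have hw' := hx y hyx
    -- A ratio below `c` would push this single factor, and with it the likelihood, below half the
    -- supremum. If `a x = 0`, the bound `c * a y ≤ a x` kills every coordinate, against total `1`.
    set c : ℝ := (likelihoodSup w / 2) ^ (w x y)⁻¹
    have hc : 0 < c := Real.rpow_pos_of_pos (half_pos hS) _
    have hle : c * a y ≤ a x := by
      refine le_of_tendsto_of_tendsto ((ha y).const_mul c) (ha x) ?_
      filter_upwards [hψS.eventually (lt_mem_nhds (half_lt_self hS))] with n hn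
      have h1 := hn.trans_le (likelihood_le_rpow hw (hψ n).1 (Ne.symm hyx))
      have hp := div_add_pos (hψ n).1 x y
      have h2 : c ≤ ψ n x / (ψ n x + ψ n y) := by
        have := Real.rpow_le_rpow (half_pos hS).le h1.le (inv_pos.2 hw').le
        rwa [← Real.rpow_mul hp.le, mul_inv_cancel₀ hw'.ne', Real.rpow_one] at this
      rw [le_div_iff₀ (add_pos ((hψ n).1 _) ((hψ n).1 _))] at h2
      nlinarith [mul_pos hc ((hψ n).1 x)]
    rw [← hzero] at hle
    by_contra hcon
    exact absurd (mul_pos hc (not_le.1 hcon)) hle.not_gt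
  have := Finset.sum_nonpos (s := Finset.univ) fun y _ => hall y
  rw [hmem.2] at this
  linarith

/-- Proportionality is read off against the one option `x`; summing over `y` gives `a x = b x`,
which can be cancelled because it is positive. -/
theorem eq_of_maximizing [Nonempty A] {w : A → A → ℝ} (hw : ∀ x y, 0 ≤ w x y)
    (hpos : ∃ x, ∀ y, y ≠ x → 0 < w x y)
    {ψ χ : ℕ → A → ℝ} (hψ : ∀ n, ψ n ∈ strengthSet A) (hχ : ∀ n, χ n ∈ strengthSet A)
    (hψS : Tendsto (fun n => likelihood w (ψ n)) atTop (𝓝 (likelihoodSup w)))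
    (hχS : Tendsto (fun n => likelihood w (χ n)) atTop (𝓝 (likelihoodSup w)))
    {a b : A → ℝ} (ha : Tendsto ψ atTop (𝓝 a)) (hb : Tendsto χ atTop (𝓝 b)) : a = b := by
  obtain ⟨x, hx⟩ := hpos
  have hmul : ∀ y, a x * b y = a y * b x := by
    intro y
    by_cases hyx : y = x
    · rw [hyx]
    · exact mul_eq_mul_of_maximizing hw hψ hχ hψS hχS ha hb (Ne.symm hyx) (hx y hyx)
  have hsa : a ∈ stdSimplex ℝ A := (isClosed_stdSimplex ℝ A).mem_of_tendsto ha
    (Eventually.of_forall fun n => strengthSet_subset_stdSimplex (hψ n))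
  have hsb : b ∈ stdSimplex ℝ A := (isClosed_stdSimplex ℝ A).mem_of_tendsto hb
    (Eventually.of_forall fun n => strengthSet_subset_stdSimplex (hχ n))
  have hab : a x = b x := by
    have := Finset.sum_congr (rfl : (Finset.univ : Finset A) = _) fun y _ => hmul y
    rwa [← Finset.mul_sum, ← Finset.sum_mul, hsa.2, hsb.2, mul_one, one_mul] at this
  have hax := pos_of_maximizing hw hψ hψS ha hx
  ext y
  have := hmul y
  rw [← hab, mul_comm (a y)] at this
  exact (mul_left_cancel₀ hax.ne' this).symm

theorem exists_isStrengths [Nonempty A] {w : A → A → ℝ} (hw : ∀ x y, 0 ≤ w x y)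
    (hpos : ∃ x, ∀ y, y ≠ x → 0 < w x y) : ∃ φ, IsStrengths w φ := by
  obtain ⟨ψ, hψ, hψS⟩ := exists_maximizing hw
  obtain ⟨φ, -, θ, hθ, hlim⟩ := (isCompact_stdSimplex ℝ A).tendsto_subseq
    fun n => strengthSet_subset_stdSimplex (hψ n)
  refine ⟨φ, mem_closure_of_tendsto hlim (Eventually.of_forall fun n => hψ _), fun χ hχ hχS => ?_⟩
  refine tendsto_of_subseq_tendsto fun ns hns => ?_
  obtain ⟨φ', -, ms, hms, hlim'⟩ := (isCompact_stdSimplex ℝ A).tendsto_subseq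
    fun n => strengthSet_subset_stdSimplex (hχ (ns n))
  have : φ' = φ := eq_of_maximizing hw hpos (fun n => hχ _) (fun n => hψ _)
    (hχS.comp (hns.comp hms.tendsto_atTop)) (hψS.comp hθ.tendsto_atTop) hlim' hlim
  exact ⟨ms, this ▸ hlim'⟩

theorem IsStrengths.unique [Nonempty A] {w : A → A → ℝ} (hw : ∀ x y, 0 ≤ w x y) {φ φ' : A → ℝ}
    (h : IsStrengths w φ) (h' : IsStrengths w φ') : φ = φ' := by
  obtain ⟨ψ, hψ, hψS⟩ := exists_maximizing hw
  exact tendsto_nhds_unique (h.2 ψ hψ hψS) (h'.2 ψ hψ hψS)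

/-! ### Continuity of the strengths -/

/-- The comparison is multiplicative so that zero entries of `w₀` need only nonnegativity of `w n`.
-/
theorem eventually_mul_le {w : ℕ → A → A → ℝ} {w₀ : A → A → ℝ} (hw : ∀ n x y, 0 ≤ w n x y)
    (hw₀ : ∀ x y, 0 ≤ w₀ x y) (h : Tendsto w atTop (𝓝 w₀)) {c : ℝ} (hc : c < 1) :
    ∀ᶠ n in atTop, ∀ x y, c * w₀ x y ≤ w n x y := by
  rw [eventually_all]; intro x
  rw [eventually_all]; intro y
  rcases (hw₀ x y).eq_or_lt with e | e
  · exact Eventually.of_forall fun n => by rw [← e, mul_zero]; exact hw n x y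
  · exact (tendsto_pi_nhds.1 (tendsto_pi_nhds.1 h x) y).eventually
      (eventually_ge_nhds (by nlinarith))

/-- Asymptotic maximizers of the likelihoods of a convergent sequence of matrices are asymptotic
maximizers of the likelihood of the limit. -/
theorem maximizing_of_tendsto [Nonempty A] {w : ℕ → A → A → ℝ} {w₀ : A → A → ℝ}
    (hw : ∀ n x y, 0 ≤ w n x y) (hw₀ : ∀ x y, 0 ≤ w₀ x y) (h : Tendsto w atTop (𝓝 w₀))
    {ψ : ℕ → A → ℝ} (hψ : ∀ n, ψ n ∈ strengthSet A) {ε : ℕ → ℝ} (hε : Tendsto ε atTop (𝓝 0))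
    (hmax : ∀ n, likelihoodSup (w n) - ε n < likelihood (w n) (ψ n)) :
    Tendsto (fun n => likelihood w₀ (ψ n)) atTop (𝓝 (likelihoodSup w₀)) := by
  refine tendsto_order.2 ⟨fun s hs => ?_, fun s hs =>
    Eventually.of_forall fun n => (likelihood_le_sup hw₀ (hψ n)).trans_lt hs⟩
  rcases le_or_gt s 0 with hs0 | hs0
  · exact Eventually.of_forall fun n => hs0.trans_lt (likelihood_pos w₀ (hψ n).1)
  obtain ⟨_, ⟨χ, hχ, rfl⟩, hsχ⟩ := exists_lt_of_lt_csSup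
    (strengthSet_nonempty.image (likelihood w₀)) hs
  obtain ⟨s', hs1, hs2⟩ := exists_between hsχ
  have hcont : Tendsto (fun c : ℝ => s ^ c) (𝓝[<] 1) (𝓝 (s ^ (1 : ℝ))) :=
    (Real.continuous_const_rpow hs0.ne').tendsto 1 |>.mono_left nhdsWithin_le_nhds
  rw [Real.rpow_one] at hcont
  -- With `s ^ c < s'`, eventually `s ^ c` is below the likelihood of `w n` at `χ` minus `ε n`,
  -- hence below that at `ψ n`, hence below the `c`-th power of the likelihood of `w₀` at `ψ n`.
  obtain ⟨c, hcs, hc⟩ := ((hcont.eventually (gt_mem_nhds hs1)).and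
    (Ioo_mem_nhdsLT (zero_lt_one (α := ℝ)))).exists
  have hlim : Tendsto (fun n => likelihood (w n) χ - ε n) atTop (𝓝 (likelihood w₀ χ - 0)) :=
    (((continuous_likelihood_left hχ.1).tendsto w₀).comp h).sub hε
  rw [sub_zero] at hlim
  filter_upwards [eventually_mul_le hw hw₀ h hc.2, hlim.eventually (lt_mem_nhds hs2)] with n h1 h2
  have h3 := likelihood_le_likelihood_rpow h1 (hψ n).1
  have h4 := likelihood_le_sup (hw n) hχ
  have h5 : s ^ c < likelihood w₀ (ψ n) ^ c := by linarith [hmax n]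
  exact (Real.rpow_lt_rpow_iff hs0.le (likelihood_pos w₀ (hψ n).1).le hc.1).1 h5

/-- The strengths may lie on the boundary of the simplex, so each `φ n` is replaced by a nearby
interior near-maximizer; the resulting sequence is maximizing for `w₀`. -/
theorem IsStrengths.tendsto [Nonempty A] {w : ℕ → A → A → ℝ} {w₀ : A → A → ℝ}
    (hw : ∀ n x y, 0 ≤ w n x y) (hw₀ : ∀ x y, 0 ≤ w₀ x y) (h : Tendsto w atTop (𝓝 w₀))
    {φ : ℕ → A → ℝ} {φ₀ : A → ℝ} (hφ : ∀ n, IsStrengths (w n) (φ n)) (hφ₀ : IsStrengths w₀ φ₀) :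
    Tendsto φ atTop (𝓝 φ₀) := by
  have hε : ∀ n : ℕ, (0 : ℝ) < 1 / (n + 1) := fun n => Nat.one_div_pos_of_nat
  have hex : ∀ n : ℕ, ∃ ψ ∈ strengthSet A,
      likelihoodSup (w n) - 1 / (n + 1) < likelihood (w n) ψ ∧ dist (φ n) ψ < 1 / (n + 1) := by
    intro n
    obtain ⟨ψ, hψ, hψS⟩ := exists_maximizing (hw n)
    have h1 := hψS.eventually (lt_mem_nhds (sub_lt_self (likelihoodSup (w n)) (hε n)))
    have h2 := (hφ n).2 ψ hψ hψS |>.eventually (Metric.ball_mem_nhds _ (hε n))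
    obtain ⟨k, h1, h2⟩ := (h1.and h2).exists
    exact ⟨ψ k, hψ k, h1, by rwa [dist_comm] at h2⟩
  choose ψ hψ hmax hdist using hex
  have h1 := hφ₀.2 ψ hψ
    (maximizing_of_tendsto hw hw₀ h hψ tendsto_one_div_add_atTop_nhds_zero_nat hmax)
  refine (tendsto_iff_of_dist ?_).2 h1
  exact squeeze_zero (fun _ => dist_nonneg) (fun n => (hdist n).le)
    tendsto_one_div_add_atTop_nhds_zero_nat

end CLC

/-! ### Assembly of the projection and the strengths. -/

theorem mainTheorem2 {A : Type*} [Fintype A] :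
    ∃ Φ : CLC.nonvanishingLlull A → A → ℝ,
      (∀ v : CLC.nonvanishingLlull A, ∃! w : A → A → ℝ, CLC.IsCLCProjection v.1 w) ∧
      (∀ (v : CLC.nonvanishingLlull A) (φ : A → ℝ), CLC.IsFractionLikeRates v.1 φ ↔ φ = Φ v) ∧
      Continuous Φ := by
  have hA : ∀ _ : CLC.nonvanishingLlull A, Nonempty A := fun v => ⟨v.2.2.choose⟩
  choose W hW using fun v : CLC.nonvanishingLlull A => v.2.1.exists_isCLCProjection
  have hφ : ∀ v, ∃ φ, CLC.IsStrengths (W v) φ := fun v =>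
    have := hA v
    CLC.exists_isStrengths (hW v).nonneg ((hW v).exists_forall_pos v.2)
  choose Φ hΦ using hφ
  refine ⟨Φ, fun v => ⟨W v, hW v, fun w hw => hw.unique (hW v)⟩, fun v φ => ⟨?_, ?_⟩, ?_⟩
  · rintro ⟨w, hw, h⟩
    have := hA v
    rw [hw.unique (hW v)] at h
    exact h.unique (hW v).nonneg (hΦ v)
  · rintro rfl
    exact ⟨W v, hW v, hΦ v⟩
  · have hcont : Continuous W :=
      CLC.IsCLCProjection.continuous continuous_subtype_val (fun v => v.2.1) hW
    refine SeqContinuous.continuous fun u v hu => ?_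
    have := hA v
    exact CLC.IsStrengths.tendsto (fun n => (hW (u n)).nonneg) (hW v).nonneg
      ((hcont.tendsto v).comp hu) (fun n => hΦ (u n)) (hΦ v)
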